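/- A *variety* over a field $k$ is an integral separated $k$-scheme of finite type. For an open subset $U$ of a variety $V$ and a point $x\in V$, an *étale chart* for $U\subset V$ at $x$ is a pair $(T,\varphi)$ of an affine normal toric variety $T$ over $k$ (with split big torus) and an étale $k$-morphism $\varphi$ from an open neighbourhood of $x$ to $T$ such that, locally at $x$, $U$ is the inverse image under $\varphi$ of the big torus of $T$. The embedding $U\subset V$ is *strict toroidal* if there is an étale chart at every closed point and the irreducible components of $D=V\setminus U$ are normal. Put $\Omega^1_V(\log D)=j_*\Omega^1_{V_0}(\log D\cap V_0)$, where $j:V_0\to V$ is the open locus where $V$ and $D$ are nonsingular. A dominant $k$-morphism $f:X\to B$ that maps $U_X$ into $U_B$ is *logarithmically smooth* at $x$ if $\Omega^1_X(\log (X\setminus U_X))/f^*\Omega^1_B(\log (B\setminus U_B))$ is free at $x$. Given an étale chart $(V_B,\varphi_B)$ for $U_B\subset B$ at $f(x)$, say that $f$ *has a monomial form at $x$ over $(V_B,\varphi_B)$* if there exist a variety $X'$ and an étale $k$-morphism $\pi:X'\to X$, a closed point $x'\in X'$ with $\pi(x')=x$ and $k(x')=k(x)$, an étale chart $(V_{X'},\varphi_{X'})$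 for $\pi^{-1}(U_X)\subset X'$ at $x'$, a toric morphism $g:V_{X'}\to V_B$, and a translation $t$ of $V_B$ by a $k$-rational point of its big torus, such that $g\circ\varphi_{X'}=t\circ\varphi_B\circ f\circ\pi$ as rational maps. Let $X=\operatorname{Spec}\mathbb{Q}[x,y,y^{-1}]/(y^2-x+1)$, $U_X=X\setminus V(x)$, $B=\operatorname{Spec}\mathbb{Q}[z]$, $U_B=B\setminus V(z)$, $b=(z)\in B$, and let $f:X\to B$ be the morphism given by $z=yx^4$. Then: 1. There is exactly one point $a\in X$ with $f(a)=b$, and it is closed; the embeddings $U_X\subset X$ and $U_B\subset B$ are strict toroidal; $f$ is dominant, maps $U_X$ into $U_B$, and is logarithmically smooth at $a$. 2. There are no unit $u$ in the henselization of $\mathcal{O}_{B,b}$ and unit $v$ in the henselization of $\mathcal{O}_{X,a}$ such that $zu=(xv)^4$ in the henselization of $\mathcal{O}_{X,a}$. 3. $f$ has no monomial form at $a$ over any étale chart for $U_B\subset B$ at $b$. 4. $\sqrt{-1}$ cannot be written as $\alpha\beta^4$ with $\alpha\in\mathbb{Q}$ and $\beta\in\mathbb{Q}(\sqrt{-1})$.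 5. Consequently the following assertion is false: for every field $k$ of characteristic zero, all strict toroidal embeddings $U_X\subset X$, $U_B\subset B$ of varieties over $k$, every dominant $k$-morphism $f:X\to B$ mapping $U_X$ into $U_B$, every closed point $x\in X$ at which $f$ is logarithmically smooth, and every étale chart for $U_B\subset B$ at $f(x)$, $f$ has a monomial form at $x$ over this chart. That is, the hypothesis that $k(x)=k$ or that $k(x)$ is algebraically closed cannot simply be dropped from the corresponding proposition. -/

import Mathlib

open CategoryTheory
open scoped TensorProduct KaehlerDifferential
universe u

noncomputable section

/-- An étale neighbourhood of the closed point of `Spec A`, for a local ring `A`: an étale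
`A`-algebra (given by finitely many generators and an ideal of relations) together with a point over
the closed point whose residue field is that of `A`, that is, an `A`-algebra homomorphism to the residue
field of `A`. -/
structure EtaleNbhd (A : Type u) [CommRing A] [IsLocalRing A] : Type u where
  n : ℕ
  I : Ideal (MvPolynomial (Fin n) A)
  etale : Algebra.Etale A (MvPolynomial (Fin n) A ⧸ I)
  pt : (MvPolynomial (Fin n) A ⧸ I) →ₐ[A] IsLocalRing.ResidueField A

namespace EtaleNbhd

variable {A : Type u} [CommRing A] [IsLocalRing A]

abbrev coord (N : EtaleNbhd A) : Type u := MvPolynomial (Fin N.n) A ⧸ N.I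

instance (N : EtaleNbhd A) : Algebra.Etale A N.coord := N.etale

/-- Morphisms are the algebra homomorphisms that respect the points. -/
instance : Category.{u} (EtaleNbhd A) where
  Hom N M := {φ : N.coord →ₐ[A] M.coord // M.pt.comp φ = N.pt}
  id N := ⟨AlgHom.id A N.coord, AlgHom.comp_id _⟩
  comp φ ψ := ⟨ψ.1.comp φ.1, by rw [← AlgHom.comp_assoc, ψ.2, φ.2]⟩

variable (A) in
/-- The diagram of all étale neighbourhoods. -/
def diagram : EtaleNbhd A ⥤ CommRingCat.{u} where
  obj N := CommRingCat.of N.coord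
  map φ := CommRingCat.ofHom φ.1.toRingHom

theorem exists_presentation (A S : Type u) [CommRing A] [CommRing S] [Algebra A S]
    [Algebra.Etale A S] : ∃ (n : ℕ) (I : Ideal (MvPolynomial (Fin n) A)),
    Nonempty ((MvPolynomial (Fin n) A ⧸ I) ≃ₐ[A] S) := by
  obtain ⟨n, f, hf, -⟩ := (inferInstance : Algebra.FinitePresentation A S).out
  exact ⟨n, RingHom.ker f, ⟨Ideal.quotientKerAlgEquivOfSurjective hf⟩⟩

section ofEtale

variable (S : Type u) [CommRing S] [Algebra A S] [Algebra.Etale A S]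

/-- Every étale algebra with a point gives an étale neighbourhood. -/
def ofEtale (s : S →ₐ[A] IsLocalRing.ResidueField A) : EtaleNbhd A where
  n := (exists_presentation A S).choose
  I := (exists_presentation A S).choose_spec.choose
  etale := Algebra.Etale.of_equiv (exists_presentation A S).choose_spec.choose_spec.some.symm
  pt := s.comp (exists_presentation A S).choose_spec.choose_spec.some

/-- The ring of `ofEtale S s` is `S`. -/
def ofEtaleEquiv (s : S →ₐ[A] IsLocalRing.ResidueField A) : (ofEtale S s).coord ≃ₐ[A] S :=
  (exists_presentation A S).choose_spec.choose_spec.some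

theorem pt_ofEtale (s : S →ₐ[A] IsLocalRing.ResidueField A) :
    (ofEtale S s).pt = s.comp (ofEtaleEquiv S s) := rfl

end ofEtale

end EtaleNbhd

/-- The henselization of a local ring: the colimit of all its étale neighbourhoods. -/
def Henselization (A : Type u) [CommRing A] [IsLocalRing A] : Type u :=
  (Limits.colimit (EtaleNbhd.diagram A) : CommRingCat.{u})

namespace Henselization

variable (A : Type u) [CommRing A] [IsLocalRing A]

instance : CommRing (Henselization A) :=
  inferInstanceAs (CommRing (Limits.colimit (EtaleNbhd.diagram A) : CommRingCat.{u}))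

variable {A}

/-- The map from the ring of an étale neighbourhood to the henselization. -/
def ι (N : EtaleNbhd A) : N.coord →+* Henselization A :=
  (Limits.colimit.ι (EtaleNbhd.diagram A) N).hom

theorem ι_comp {N M : EtaleNbhd A} (φ : N ⟶ M) : (ι M).comp φ.1.toRingHom = ι N :=
  congrArg CommRingCat.Hom.hom (Limits.colimit.w (EtaleNbhd.diagram A) φ)

/-- Ring homomorphisms out of the henselization. -/
def desc {R : Type u} [CommRing R] (c : ∀ N : EtaleNbhd A, N.coord →+* R)
    (hc : ∀ {N M : EtaleNbhd A} (φ : N ⟶ M), (c M).comp φ.1.toRingHom = c N) :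
    Henselization A →+* R :=
  CommRingCat.Hom.hom (Limits.colimit.desc (EtaleNbhd.diagram A)
    { pt := CommRingCat.of R
      ι :=
        { app := fun N => CommRingCat.ofHom (c N)
          naturality := fun _ _ φ => congrArg CommRingCat.ofHom (hc φ) } })

theorem desc_comp_ι {R : Type u} [CommRing R] (c : ∀ N : EtaleNbhd A, N.coord →+* R)
    (hc : ∀ {N M : EtaleNbhd A} (φ : N ⟶ M), (c M).comp φ.1.toRingHom = c N) (N : EtaleNbhd A) :
    (desc c hc).comp (ι N) = c N :=
  congrArg CommRingCat.Hom.hom (Limits.colimit.ι_desc (F := EtaleNbhd.diagram A) _ N)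

variable (A) in
/-- The canonical homomorphism from a local ring to its henselization. -/
def of : A →+* Henselization A :=
  (ι (EtaleNbhd.ofEtale A (Algebra.ofId A (IsLocalRing.ResidueField A)))).comp (algebraMap A _)

theorem ι_algebraMap (N : EtaleNbhd A) (a : A) : ι N (algebraMap A N.coord a) = of A a := by
  let N₀ := EtaleNbhd.ofEtale A (Algebra.ofId A (IsLocalRing.ResidueField A))
  let e : N₀.coord ≃ₐ[A] A := EtaleNbhd.ofEtaleEquiv A (Algebra.ofId A _)
  let φ : N₀ ⟶ N := ⟨(Algebra.ofId A N.coord).comp e, by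
    rw [EtaleNbhd.pt_ofEtale, ← AlgHom.comp_assoc]
    congr 1
    exact Subsingleton.elim _ _⟩
  have h : (ι N).comp φ.1.toRingHom = ι N₀ := ι_comp φ
  have h2 : φ.1 (algebraMap A N₀.coord a) = algebraMap A N.coord a := φ.1.commutes a
  rw [← h2]
  exact congrArg (fun r => r (algebraMap A N₀.coord a)) h

section map

variable {A' : Type u} [CommRing A'] [IsLocalRing A'] [Algebra A A'] [IsLocalHom (algebraMap A A')]

/-- The base change to `A'` of the point of an étale neighbourhood of `A`: `a' ⊗ x ↦ a' * N.pt x`. -/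
def basePt (N : EtaleNbhd A) : TensorProduct A A' N.coord →ₐ[A'] IsLocalRing.ResidueField A' :=
  Algebra.TensorProduct.lift (Algebra.ofId A' _)
    ((IsScalarTower.toAlgHom A (IsLocalRing.ResidueField A) (IsLocalRing.ResidueField A')).comp N.pt)
    (fun _ _ => Commute.all _ _)

variable (A') in
/-- The base change to `A'` of an étale neighbourhood of `A`. -/
def baseChange (N : EtaleNbhd A) : EtaleNbhd A' :=
  EtaleNbhd.ofEtale (TensorProduct A A' N.coord) (basePt N)

variable (A') in
/-- The ring of the base change is the tensor product. -/
def baseChangeEquiv (N : EtaleNbhd A) : (baseChange A' N).coord ≃ₐ[A'] TensorProduct A A' N.coord :=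
  EtaleNbhd.ofEtaleEquiv (TensorProduct A A' N.coord) (basePt N)

variable (A') in
/-- The map `N.coord → A' ⊗ N.coord`. -/
def toBaseChange (N : EtaleNbhd A) : N.coord →+* (baseChange A' N).coord :=
  RingHom.comp (RingHomClass.toRingHom (baseChangeEquiv A' N).symm)
    (RingHomClass.toRingHom
      (Algebra.TensorProduct.includeRight : N.coord →ₐ[A] TensorProduct A A' N.coord))

theorem toBaseChange_apply (N : EtaleNbhd A) (x : N.coord) :
    toBaseChange A' N x = (baseChangeEquiv A' N).symm (1 ⊗ₜ[A] x) := rfl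

theorem pt_baseChange (N : EtaleNbhd A) :
    (baseChange A' N).pt = (basePt N).comp (baseChangeEquiv A' N : _ →ₐ[A'] _) := rfl

variable (A') in
/-- Base change of morphisms of étale neighbourhoods. -/
def baseChangeHom {N M : EtaleNbhd A} (φ : N ⟶ M) : baseChange A' N ⟶ baseChange A' M :=
  ⟨((baseChangeEquiv A' M).symm : _ →ₐ[A'] _).comp
    ((Algebra.TensorProduct.map (AlgHom.id A' A') φ.1).comp (baseChangeEquiv A' N : _ →ₐ[A'] _)), by
    have h : (basePt (A' := A') M).comp (Algebra.TensorProduct.map (AlgHom.id A' A') φ.1) =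
        basePt N := by
      apply Algebra.TensorProduct.ext'
      intro a b
      simp only [basePt, AlgHom.comp_apply, Algebra.TensorProduct.map_tmul,
        Algebra.TensorProduct.lift_tmul, ← φ.2, AlgHom.id_apply]
    rw [pt_baseChange, pt_baseChange, ← h]
    apply AlgHom.ext
    intro x
    exact congrArg (basePt M) ((baseChangeEquiv A' M).apply_symm_apply _)⟩

theorem baseChangeHom_toBaseChange {N M : EtaleNbhd A} (φ : N ⟶ M) (x : N.coord) :
    (baseChangeHom A' φ).1 (toBaseChange A' N x) = toBaseChange A' M (φ.1 x) := by
  refine congrArg (baseChangeEquiv A' M).symm ?_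
  refine (congrArg (Algebra.TensorProduct.map (AlgHom.id A' A') φ.1)
    ((baseChangeEquiv A' N).apply_symm_apply (1 ⊗ₜ[A] x))).trans ?_
  rw [Algebra.TensorProduct.map_tmul, map_one]
  rfl

theorem ι_toBaseChange {N M : EtaleNbhd A} (φ : N ⟶ M) :
    ((ι (baseChange A' M)).comp (toBaseChange A' M)).comp φ.1.toRingHom =
      (ι (baseChange A' N)).comp (toBaseChange A' N) := by
  have key := ι_comp (baseChangeHom A' φ)
  apply RingHom.ext
  intro x
  have e : ι (baseChange A' M) ((baseChangeHom A' φ).1 (toBaseChange A' N x)) =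
    ι (baseChange A' N) (toBaseChange A' N x) :=
    congrArg (fun r => r (toBaseChange A' N x)) key
  rw [baseChangeHom_toBaseChange] at e
  exact e

theorem toBaseChange_algebraMap (N : EtaleNbhd A) (a : A) :
    toBaseChange A' N (algebraMap A N.coord a) =
      algebraMap A' (baseChange A' N).coord (algebraMap A A' a) := by
  rw [toBaseChange_apply, AlgEquiv.symm_apply_eq, AlgEquiv.commutes,
    Algebra.TensorProduct.algebraMap_apply, Algebra.algebraMap_self_apply,
    Algebra.algebraMap_eq_smul_one, Algebra.algebraMap_eq_smul_one, TensorProduct.tmul_smul,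
    TensorProduct.smul_tmul']

end map

/-- The homomorphism of henselizations induced by a local homomorphism `f : A → A'`: on the ring of an
étale neighbourhood `N` of `A` it is `N.coord → A' ⊗ N.coord`. -/
def map {A' : Type u} [CommRing A'] [IsLocalRing A'] (f : A →+* A') [IsLocalHom f] :
    Henselization A →+* Henselization A' :=
  letI := f.toAlgebra
  haveI : IsLocalHom (algebraMap A A') := ‹IsLocalHom f›
  desc (fun N => (ι (baseChange A' N)).comp (toBaseChange A' N)) ι_toBaseChange

theorem map_of {A' : Type u} [CommRing A'] [IsLocalRing A'] (f : A →+* A') [IsLocalHom f] (a : A) :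
    map f (of A a) = of A' (f a) := by
  let _ := f.toAlgebra
  have : IsLocalHom (algebraMap A A') := ‹IsLocalHom f›
  let N : EtaleNbhd A := EtaleNbhd.ofEtale A (Algebra.ofId A (IsLocalRing.ResidueField A))
  have h : map f (ι N (algebraMap A N.coord a)) =
      ι (baseChange A' N) (toBaseChange A' N (algebraMap A N.coord a)) :=
    congrArg (fun r => r (algebraMap A N.coord a))
      (desc_comp_ι (fun N => (ι (baseChange A' N)).comp (toBaseChange A' N)) ι_toBaseChange N)
  rw [toBaseChange_algebraMap, ι_algebraMap, ι_algebraMap] at h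
  exact h

end Henselization
section Varieties

open AlgebraicGeometry

/-- An algebraic variety over `k`: an integral separated scheme of finite type over `k`. -/
structure Variety (k : Type) [Field k] where
  X : Scheme.{0}
  str : X ⟶ Spec (CommRingCat.of k)
  isIntegral : AlgebraicGeometry.IsIntegral X
  isSeparated : IsSeparated str
  locallyOfFiniteType : LocallyOfFiniteType str
  quasiCompact : QuasiCompact str

attribute [instance] Variety.isIntegral Variety.isSeparated Variety.locallyOfFiniteType
  Variety.quasiCompact

variable {k : Type} [Field k]

/-- `k`-morphisms of varieties. -/
structure Variety.Hom (X B : Variety k) where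
  hom : X.X ⟶ B.X
  w : hom ≫ B.str = X.str

namespace Variety

/-- The function field of a variety. -/
abbrev K (V : Variety k) : Type := V.X.functionField

/-- The function field is a `k`-algebra through the structure morphism. -/
instance (V : Variety k) : Algebra k V.K :=
  ((Scheme.ΓSpecIso (CommRingCat.of k)).inv ≫ V.str.appTop ≫
    V.X.presheaf.germ ⊤ (genericPoint V.X) (TopologicalSpace.Opens.mem_top _)).hom.toAlgebra

namespace Hom

variable {X B : Variety k} (f : Hom X B)

theorem apply_genericPoint [IsDominant f.hom] :
    f.hom (genericPoint X.X) = genericPoint B.X := by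
  have h := (genericPoint_spec X.X).image f.hom.continuous
  rw [Set.image_univ, f.hom.denseRange.closure_range] at h
  exact h.eq (genericPoint_spec B.X)

/-- The inclusion of function fields induced by a dominant morphism. -/
def funMap [IsDominant f.hom] : B.K →ₐ[k] X.K where
  __ := (B.X.presheaf.stalkSpecializes (specializes_of_eq f.apply_genericPoint) ≫
    f.hom.stalkMap (genericPoint X.X)).hom
  commutes' r := by
    have h : B.str.appTop ≫ B.X.presheaf.germ ⊤ (genericPoint B.X) (TopologicalSpace.Opens.mem_top _) ≫
        (B.X.presheaf.stalkSpecializes (specializes_of_eq f.apply_genericPoint) ≫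
          f.hom.stalkMap (genericPoint X.X)) =
        X.str.appTop ≫ X.X.presheaf.germ ⊤ (genericPoint X.X) (TopologicalSpace.Opens.mem_top _) := by
      rw [TopCat.Presheaf.germ_stalkSpecializes_assoc]
      have e := Scheme.Hom.germ_stalkMap f.hom ⊤ (genericPoint X.X) (TopologicalSpace.Opens.mem_top _)
      refine (congrArg (B.str.appTop ≫ ·) e).trans ?_
      simp only [← f.w, Scheme.Hom.comp_appTop, Category.assoc]
      rfl
    exact congrArg (fun u => u.hom ((Scheme.ΓSpecIso (CommRingCat.of k)).inv.hom r)) h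

end Hom

end Variety

/-- Pull-back of differential forms along an embedding of fields: `a db ↦ φ a d(φ b)`. -/
def pullForm {L K : Type} [Field L] [Field K] [Algebra k L] [Algebra k K] (φ : L →ₐ[k] K) :
    Ω[L⁄k] →+ Ω[K⁄k] :=
  letI := φ.toRingHom.toAlgebra
  haveI : IsScalarTower k L K := IsScalarTower.of_algebraMap_eq fun r => (φ.commutes r).symm
  (KaehlerDifferential.map k k L K).toAddMonoidHom

theorem pullForm_smul_D {L K : Type} [Field L] [Field K] [Algebra k L] [Algebra k K]
    (φ : L →ₐ[k] K) (a b : L) : pullForm φ (a • KaehlerDifferential.D k L b) =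
      φ a • KaehlerDifferential.D k K (φ b) := by
  let _ : Algebra L K := φ.toRingHom.toAlgebra
  have _ : IsScalarTower k L K := IsScalarTower.of_algebraMap_eq fun r => (φ.commutes r).symm
  change KaehlerDifferential.map k k L K (a • KaehlerDifferential.D k L b) = _
  rw [map_smul, KaehlerDifferential.map_D, algebra_compatible_smul K a]
  rfl

/-! ### Toric varieties -/

/-- The combinatorial datum of an affine toric variety: the finitely generated saturated
submonoid of regular characters in the character lattice `ℤⁿ` of the big torus. -/
structure AffineToric where
  n : ℕ
  S : AddSubmonoid (Fin n → ℤ)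
  fg : S.FG
  gen : AddSubgroup.closure (S : Set (Fin n → ℤ)) = ⊤
  saturated : ∀ (d : ℕ) (m : Fin n → ℤ), 0 < d → d • m ∈ S → m ∈ S

namespace AffineToric

variable (k) (V : AffineToric)

/-- The affine toric variety `Spec k[S]`. -/
def scheme : Scheme.{0} := Spec (CommRingCat.of (AddMonoidAlgebra k V.S))

/-- The structure morphism to `Spec k`. -/
def str : V.scheme k ⟶ Spec (CommRingCat.of k) :=
  Spec.map (CommRingCat.ofHom (algebraMap k (AddMonoidAlgebra k V.S)))

/-- The big torus, as a subset: the image of `Spec k[ℤⁿ]`. -/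
def torus : Set (V.scheme k) :=
  Set.range (Spec.map (CommRingCat.ofHom
    (AddMonoidAlgebra.mapDomainAlgHom k k V.S.subtype).toRingHom))

variable {V}

/-- The toric morphism `Spec k[S] → Spec k[S']` attached to a monoid homomorphism `S' → S`. -/
def toricMap {V' : AffineToric} (g : V'.S →+ V.S) : V.scheme k ⟶ V'.scheme k :=
  Spec.map (CommRingCat.ofHom (AddMonoidAlgebra.mapDomainAlgHom k k g).toRingHom)

variable {k}

/-- The translation of the toric variety by a `k`-rational point `t : ℤⁿ → kˣ` of the big torus; on
characters it is `χ ↦ t χ • χ`. -/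
def translation (t : Multiplicative (Fin V.n → ℤ) →* kˣ) : V.scheme k ⟶ V.scheme k :=
  Spec.map (CommRingCat.ofHom (AddMonoidAlgebra.lift k (AddMonoidAlgebra k V.S) V.S
    { toFun := fun m => AddMonoidAlgebra.single m.toAdd
        (t (Multiplicative.ofAdd (m.toAdd : Fin V.n → ℤ)) : k)
      map_one' := by simp [AddMonoidAlgebra.one_def]
      map_mul' := fun a b => by simp [AddMonoidAlgebra.single_mul_single] }).toRingHom)

end AffineToric

/-! ### Toroidal embeddings -/

/-- An étale chart at `x` for an open subset `U` of a variety `V`: an étale `k`-morphism `φ` from an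
open neighbourhood `W` of `x` to an affine toric variety such that, locally at `x`, `U` is the inverse
image of the big torus. -/
structure EtaleChart (V : Variety k) (U : V.X.Opens) (x : V.X) where
  T : AffineToric
  W : V.X.Opens
  mem : x ∈ W
  φ : W.toScheme ⟶ T.scheme k
  w : φ ≫ T.str k = W.ι ≫ V.str
  etale : Etale φ
  preimage_torus : ∃ W' : V.X.Opens, x ∈ W' ∧
    ∀ y : W.toScheme, W.ι y ∈ W' → (W.ι y ∈ U ↔ φ y ∈ T.torus k)

/-- The ideal, in the local ring at `p`, of the closed subset `Z` with its reduced structure. -/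
def localIdeal {X : Scheme.{0}} (Z : Set X) (p : X) : Ideal (X.presheaf.stalk p) :=
  PrimeSpectrum.vanishingIdeal (X.fromSpecStalk p ⁻¹' Z)

/-- `U ⊆ V` is a strict toroidal embedding: every closed point has an étale chart (on a Zariski
neighbourhood), and the irreducible components of the complement, with their reduced structure, are
normal. -/
def IsStrictToroidal (V : Variety k) (U : V.X.Opens) : Prop :=
  (∀ x : V.X, IsClosed {x} → Nonempty (EtaleChart V U x)) ∧
  ∀ Z : Set V.X, Maximal (fun Z => IsIrreducible Z ∧ Z ⊆ (U : Set V.X)ᶜ) Z → ∀ p ∈ Z,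
    IsDomain (V.X.presheaf.stalk p ⧸ localIdeal Z p) ∧
      IsIntegrallyClosed (V.X.presheaf.stalk p ⧸ localIdeal Z p)

/-! ### Logarithmic differential forms and logarithmic smoothness -/

section Log

variable (V : Variety k) (U : V.X.Opens)

/-- `V` and the boundary `D = V \ U` are both nonsingular at `p` (or `p ∉ D`). -/
def IsNonsingularAt (p : V.X) : Prop :=
  IsRegularLocalRing (V.X.presheaf.stalk p) ∧
    (p ∈ U ∨ IsRegularLocalRing (V.X.presheaf.stalk p ⧸ localIdeal (U : Set V.X)ᶜ p))

/-- The stalk of `Ω¹(log D)` at a point `p` where `V` and `D` are nonsingular, inside the module of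
differentials of the function field: it is generated by the `dg`, `g` regular at `p`, and by
`dh / h` for `h` a local equation of `D` at `p`. -/
def logGerms (p : V.X) : Submodule (V.X.presheaf.stalk p) Ω[V.K⁄k] :=
  Submodule.span _
    ({ω | ∃ g : V.X.presheaf.stalk p, ω = KaehlerDifferential.D k V.K (algebraMap _ V.K g)} ∪
     {ω | ∃ h : V.X.presheaf.stalk p, Ideal.span {h} = localIdeal (U : Set V.X)ᶜ p ∧
        ω = (algebraMap _ V.K h)⁻¹ • KaehlerDifferential.D k V.K (algebraMap _ V.K h)})

/-- The stalk at `x` of `Ω¹(log D) = j_* Ω¹_{V₀}(log (D ∩ V₀))`, where `V₀` is the locus where `V`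
and `D` are nonsingular: the forms that are logarithmic at all points of `V₀` in some neighbourhood
of `x`. -/
def logForms (x : V.X) : Submodule (V.X.presheaf.stalk x) Ω[V.K⁄k] where
  carrier := {ω | ∃ W : V.X.Opens, x ∈ W ∧ ∀ p ∈ W, IsNonsingularAt V U p → ω ∈ logGerms V U p}
  add_mem' := by
    rintro a b ⟨W, hW, h⟩ ⟨W', hW', h'⟩
    exact ⟨W ⊓ W', ⟨hW, hW'⟩, fun p hp hn => add_mem (h p hp.1 hn) (h' p hp.2 hn)⟩
  zero_mem' := ⟨⊤, trivial, fun _ _ _ => zero_mem _⟩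
  smul_mem' := by
    rintro c ω ⟨W, hW, h⟩
    obtain ⟨W', hW', s, rfl⟩ := V.X.presheaf.exists_germ_eq c
    refine ⟨W ⊓ W', ⟨hW, hW'⟩, fun p hp hn => ?_⟩
    have : Nonempty W' := ⟨⟨x, hW'⟩⟩
    have := (logGerms V U p).smul_mem (V.X.presheaf.germ W' p hp.2 s) (h p hp.1 hn)
    rw [algebra_compatible_smul V.K] at this ⊢
    rw [Scheme.algebraMap_germ_eq_germToFunctionField] at this ⊢
    exact this

end Log

/-- A dominant `k`-morphism `f : X → B` mapping `UX` into `UB` is logarithmically smooth at `x` if the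
stalk at `x` of `Ω¹_X(log D_X) / f^* Ω¹_B(log D_B)` is free. -/
def IsLogSmoothAt {X B : Variety k} (UX : X.X.Opens) (UB : B.X.Opens) (f : X.Hom B) (x : X.X) :
    Prop :=
  UX ≤ f.hom ⁻¹ᵁ UB ∧ ∃ _ : IsDominant f.hom,
    Module.Free (X.X.presheaf.stalk x)
      (logForms X UX x ⧸ (Submodule.span (X.X.presheaf.stalk x)
        (pullForm f.funMap '' (logForms B UB (f.hom x) : Set Ω[B.K⁄k]))).submoduleOf
          (logForms X UX x))

/-- The chart `c` of the target of `f : X → B` at `f x` extends to a monomial form of `f` at `x`: there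
are an étale `π : X' → X`, a closed point `x'` over `x` with the same residue field, an étale chart
`c'` at `x'` for the inverse image of `UX`, a toric morphism `g` and a translation `t` by a `k`-rational
point of the big torus such that `g ∘ φ_{X'} = t ∘ φ_B ∘ f ∘ π` as rational maps (that is, wherever
both sides are defined). -/
def HasMonomialForm {X B : Variety k} (UX : X.X.Opens) (UB : B.X.Opens) (f : X.Hom B) (x : X.X)
    (c : EtaleChart B UB (f.hom x)) : Prop :=
  ∃ (X' : Variety k) (π : X'.Hom X) (x' : X'.X) (c' : EtaleChart X' (π.hom ⁻¹ᵁ UX) x')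
    (g : c.T.S →+ c'.T.S) (t : Multiplicative (Fin c.T.n → ℤ) →* kˣ),
    Etale π.hom ∧ IsClosed {x'} ∧ π.hom x' = x ∧
    Function.Bijective (π.hom.residueFieldMap x') ∧
    X'.X.homOfLE (inf_le_left : c'.W ⊓ (π.hom ≫ f.hom) ⁻¹ᵁ c.W ≤ c'.W) ≫ c'.φ ≫
        AffineToric.toricMap k g =
      (π.hom ≫ f.hom).resLE c.W (c'.W ⊓ (π.hom ≫ f.hom) ⁻¹ᵁ c.W) inf_le_right ≫ c.φ ≫
        AffineToric.translation t

end Varieties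

/-! ### The example -/

namespace Example

open AlgebraicGeometry Polynomial

/-- The ring `ℚ[x, y, y⁻¹]`. -/
abbrev P : Type := Localization.Away (MvPolynomial.X 1 : MvPolynomial (Fin 2) ℚ)

/-- The element `x` of `ℚ[x, y, y⁻¹]`. -/
def xP : P := algebraMap (MvPolynomial (Fin 2) ℚ) P (MvPolynomial.X 0)

/-- The element `y` of `ℚ[x, y, y⁻¹]`. -/
def yP : P := algebraMap (MvPolynomial (Fin 2) ℚ) P (MvPolynomial.X 1)

/-- The ring `ℚ[x, y, y⁻¹] / (y² - x + 1)`. -/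
abbrev R : Type := P ⧸ Ideal.span {yP ^ 2 - xP + 1}

/-- The class of `x`. -/
def x : R := Ideal.Quotient.mk _ xP

/-- The class of `y`. -/
def y : R := Ideal.Quotient.mk _ yP

theorem rel : x = y ^ 2 + 1 := by
  have h : Ideal.Quotient.mk (Ideal.span {yP ^ 2 - xP + 1}) (yP ^ 2 - xP + 1) = 0 :=
    Ideal.Quotient.eq_zero_iff_mem.mpr (Ideal.subset_span rfl)
  rw [map_add, map_sub, map_pow, map_one] at h
  change y ^ 2 - x + 1 = 0 at h
  linear_combination -h

theorem isUnit_y : IsUnit y :=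
  (IsLocalization.Away.algebraMap_isUnit (MvPolynomial.X 1 : MvPolynomial (Fin 2) ℚ)).map
    (Ideal.Quotient.mk (Ideal.span {yP ^ 2 - xP + 1}))

/-- The homomorphism `R → ℚ(T)` with `x ↦ T² + 1` and `y ↦ T`. -/
def toRatFunc : R →+* FractionRing ℚ[X] :=
  Ideal.Quotient.lift _
    (IsLocalization.Away.lift (MvPolynomial.X 1 : MvPolynomial (Fin 2) ℚ)
      (g := (MvPolynomial.aeval ![algebraMap ℚ[X] (FractionRing ℚ[X]) (X ^ 2 + 1),
        algebraMap ℚ[X] (FractionRing ℚ[X]) X]).toRingHom) (by simp))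
    (by
      intro a ha
      rw [← RingHom.mem_ker]
      revert a
      rw [← SetLike.le_def, Ideal.span_singleton_le_iff_mem, RingHom.mem_ker]
      simp [xP, yP])

theorem toRatFunc_y : toRatFunc y = algebraMap ℚ[X] (FractionRing ℚ[X]) X := by
  rw [toRatFunc, y, Ideal.Quotient.lift_mk, yP, IsLocalization.Away.lift_eq]
  simp

theorem exists_pow_mul (c : R) : ∃ (n : ℕ) (p : ℚ[X]), y ^ n * c = aeval y p := by
  obtain ⟨c, rfl⟩ := Ideal.Quotient.mk_surjective c
  obtain ⟨n, q, h⟩ := IsLocalization.Away.surj (MvPolynomial.X 1 : MvPolynomial (Fin 2) ℚ) c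
  have key (q : MvPolynomial (Fin 2) ℚ) : ∃ p : ℚ[X],
      Ideal.Quotient.mk (Ideal.span {yP ^ 2 - xP + 1}) (algebraMap _ P q) = aeval y p := by
    induction q using MvPolynomial.induction_on with
    | C a => exact ⟨C a, by rw [aeval_C]; rfl⟩
    | add p q hp hq =>
      obtain ⟨p', hp⟩ := hp
      obtain ⟨q', hq⟩ := hq
      exact ⟨p' + q', by rw [map_add, map_add, map_add, hp, hq]⟩
    | mul_X p i hp =>
      obtain ⟨p', hp⟩ := hp
      fin_cases i
      · refine ⟨p' * (X ^ 2 + 1), ?_⟩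
        rw [map_mul, map_mul, hp, map_mul]
        have e : aeval y (X ^ 2 + 1 : ℚ[X]) = x := by
          rw [rel, map_add, map_pow, aeval_X, map_one]
        rw [e]
        rfl
      · refine ⟨p' * X, ?_⟩
        rw [map_mul, map_mul, hp, map_mul, aeval_X]
        rfl
  obtain ⟨p, hp⟩ := key q
  refine ⟨n, p, ?_⟩
  rw [← hp, ← h, map_mul, map_pow, mul_comm]
  rfl

theorem toRatFunc_injective : Function.Injective toRatFunc := by
  rw [injective_iff_map_eq_zero]
  intro c hc
  obtain ⟨n, p, h⟩ := exists_pow_mul c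
  have h1 : toRatFunc (aeval y p) = algebraMap ℚ[X] (FractionRing ℚ[X]) p := by
    have e : (toRatFunc.comp (aeval y : ℚ[X] →ₐ[ℚ] R).toRingHom) =
        algebraMap ℚ[X] (FractionRing ℚ[X]) :=
      Polynomial.ringHom_ext' (Subsingleton.elim _ _) (by simpa using toRatFunc_y)
    exact congrArg (fun r => r p) e
  have hp : p = 0 := by
    have := congrArg toRatFunc h
    rw [map_mul, hc, mul_zero, h1] at this
    exact (IsFractionRing.injective ℚ[X] (FractionRing ℚ[X])) (by rw [← this, map_zero])
  rw [hp, map_zero] at h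
  exact (isUnit_y.pow n).mul_right_eq_zero.mp h

instance : IsDomain R := toRatFunc_injective.isDomain

/-- The affine variety of a finitely generated `ℚ`-algebra without zero divisors. -/
def affineVariety (A : Type) [CommRing A] [IsDomain A] [Algebra ℚ A] [Algebra.FiniteType ℚ A] :
    Variety ℚ where
  X := Spec (CommRingCat.of A)
  str := Spec.map (CommRingCat.ofHom (algebraMap ℚ A))
  isIntegral := inferInstance
  isSeparated := inferInstance
  locallyOfFiniteType := by
    rw [HasRingHomProperty.Spec_iff (P := @LocallyOfFiniteType)]
    exact RingHom.finiteType_algebraMap.mpr ‹_›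
  quasiCompact := inferInstance

/-- The curve `X = Spec ℚ[x, y, y⁻¹] / (y² - x + 1)`. -/
abbrev curve : Variety ℚ := affineVariety R

/-- The complement of the locus `x = 0` in `X`. -/
def curveU : curve.X.Opens := PrimeSpectrum.basicOpen x

/-- The affine line `B = Spec ℚ[z]`. -/
abbrev line : Variety ℚ := affineVariety ℚ[X]

/-- The complement of the locus `z = 0` in `B`. -/
def lineU : line.X.Opens := PrimeSpectrum.basicOpen (X : ℚ[X])

/-- The point `z = 0` of `B`. -/
def b : line.X :=
  (⟨Ideal.span {X}, (Ideal.span_singleton_prime X_ne_zero).mpr prime_X⟩ : PrimeSpectrum ℚ[X])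

/-- The morphism `f : X → B` given by `z = y x⁴`. -/
def f : curve.Hom line where
  hom := Spec.map (CommRingCat.ofHom (aeval (y * x ^ 4) : ℚ[X] →ₐ[ℚ] R).toRingHom)
  w := by
    refine (Spec.map_comp _ _).symm.trans ?_
    rw [← CommRingCat.ofHom_comp]
    congr 2
    exact (aeval (y * x ^ 4) : ℚ[X] →ₐ[ℚ] R).comp_algebraMap

/-- The germ of a regular function on an affine variety. -/
def germ {A : Type} [CommRing A] [IsDomain A] [Algebra ℚ A] [Algebra.FiniteType ℚ A]
    (p : (affineVariety A).X) : A →+* (affineVariety A).X.presheaf.stalk p :=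
  (StructureSheaf.toStalk A p).hom

end Example
end

/-!
The function `x` generates the maximal ideal of the curve at the only point `a` over `b`, and there
`y² = -1`, so the residue field of `a` is `ℚ(√-1)`, while that of `b` is `ℚ`. The map is `z = y x⁴`.
If the factor `y` could be absorbed into units on `B` and fourth powers of units on `X`, its residue
`√-1` would be a rational number times a fourth power of an element of `ℚ(√-1)`. But `√-1 = r (p + q
√-1)⁴` with `r`, `p`, `q` rational is impossible: the real part `p⁴ - 6 p² q² + q⁴` of the fourth
power would vanish, and `p⁴ - 6 p² q² + q⁴ = (p² - q²)² - 4 p² q²` makes `√2` rational unless `q =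
0` (`sqrt_neg_one_ne_mul_pow_four`); and for `q = 0` the right side is rational.

To read off residues in the henselization, the unique lifting property of étale algebras along
nilpotent thickenings gives homomorphisms from the henselization of `A` to all `A / 𝔪ⁿ⁺¹`; for `n =
4`, the common factor `x⁴` can be cancelled up to elements of the maximal ideal
(`Henselization.toResidue_eq_of_pow_mul_eq`).

For a monomial form, the étale charts of `X'` and of the line have toric targets of dimension at
most one, by comparing transcendence degrees (`AlgebraicGeometry.toric_n_le_one_of_etale`), so that
under a boundary point the chart is given by one generating character, whose pullback is a
uniformizer (`EtaleChart.exists_generator`). The pullbacks of the two generators are `x` times a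
unit, and `z` times a unit with rational residue. The equation of a monomial form identifies a power
of the first with a rational multiple of the second, and comparing orders, the power is the fourth.
This is again a relation of the excluded kind between residues (`Example.not_hasMonomialForm`).

Logarithmic smoothness at `a` holds because `z = y x⁴` gives `dz / z = dy / y + 4 dx / x`, and `dx =
2 y dy`, so that `dz / z` is `dx / x` times the unit `4 + x / (2 y²)` and generates the logarithmic
forms at `a` (`Example.isLogSmoothAt_a`).
-/

/-! ### Fourth powers in `ℚ(√-1)` -/

/-- The numbers `p + q√-1` with rational `p`, `q` form a field: they are closed under inversion. -/
theorem exists_inv_eq_add_mul_sqrt_neg_one {F : Type*} [Field F] [CharZero F] {i : F}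
    (hi : i ^ 2 = -1) (p q : ℚ) : ∃ p' q' : ℚ, ((p : F) + q * i)⁻¹ = (p' : F) + q' * i := by
  by_cases h : (p : F) + q * i = 0
  · exact ⟨0, 0, by rw [h]; simp⟩
  have hn : p ^ 2 + q ^ 2 ≠ 0 := by
    intro h0
    have hp : p = 0 := by nlinarith [sq_nonneg p, sq_nonneg q]
    have hq : q = 0 := by nlinarith [sq_nonneg p, sq_nonneg q]
    exact h (by simp [hp, hq])
  have hn' : (p : F) ^ 2 + (q : F) ^ 2 ≠ 0 := by exact_mod_cast hn
  refine ⟨p / (p ^ 2 + q ^ 2), -q / (p ^ 2 + q ^ 2), ?_⟩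
  rw [inv_eq_iff_eq_inv, eq_comm, inv_eq_iff_eq_inv]
  apply eq_inv_of_mul_eq_one_left
  push_cast
  field_simp
  linear_combination -(q : F) ^ 2 * hi

/-- If `√-1 = α β⁴` with `β = p + q√-1`, the rational part of `β⁴` vanishes:
`(p² - q²)² = (2pq)²`, so `(p ∓ q)² = 2q²`, which is impossible as `√2` is irrational. -/
theorem sqrt_neg_one_ne_mul_pow_four {F : Type*} [Field F] [CharZero F] {i : F}
    (hi : i ^ 2 = -1) (α p q : ℚ) : i ≠ (α : F) * ((p : F) + q * i) ^ 4 := by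
  intro h
  have indep (r s : ℚ) (hrs : (r : F) + s * i = 0) : r = 0 ∧ s = 0 := by
    have h1 : (r : F) ^ 2 + (s : F) ^ 2 = 0 := by
      linear_combination (r - s * i) * hrs + (s : F) ^ 2 * hi
    have h2 : r ^ 2 + s ^ 2 = 0 := by exact_mod_cast h1
    constructor <;> nlinarith [sq_nonneg r, sq_nonneg s]
  have hexp : ((p : F) + q * i) ^ 4 =
      ((p ^ 2 - q ^ 2) ^ 2 - (2 * p * q) ^ 2) + 4 * p * q * (p ^ 2 - q ^ 2) * i := by
    linear_combination (6 * (p : F) ^ 2 * q ^ 2 + 4 * p * q ^ 3 * i + (q : F) ^ 4 * (i ^ 2 - 1)) * hi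
  obtain ⟨h1, h2⟩ := indep (α * ((p ^ 2 - q ^ 2) ^ 2 - (2 * p * q) ^ 2))
    (α * (4 * p * q * (p ^ 2 - q ^ 2)) - 1) (by
      push_cast
      rw [hexp] at h
      linear_combination -h)
  have hα : α ≠ 0 := by
    rintro rfl
    simp at h2
  have h3 := (mul_eq_zero.mp h1).resolve_left hα
  have two (r s : ℚ) (hrs : r ^ 2 = 2 * s ^ 2) : s = 0 := by
    by_contra hs
    have h5 : (r / s) ^ 2 = 2 := by
      field_simp
      linear_combination hrs
    apply (irrational_sqrt_two)
    refine ⟨|r / s|, ?_⟩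
    rw [eq_comm, Real.sqrt_eq_iff_mul_self_eq (by norm_num) (by positivity)]
    have : |r / s| * |r / s| = 2 := by rw [abs_mul_abs_self, ← h5]; ring
    exact_mod_cast this.symm
  have hq : q = 0 := by
    have h4 : (p ^ 2 - q ^ 2 - 2 * p * q) * (p ^ 2 - q ^ 2 + 2 * p * q) = 0 := by
      linear_combination h3
    rcases mul_eq_zero.mp h4 with h5 | h5
    · exact two (p - q) q (by linear_combination h5)
    · exact two (p + q) q (by linear_combination h5)
  simp [hq] at h2

theorem not_exists_I_eq_mul_pow_four : ¬ ∃ (α : ℚ) (β : ℂ),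
    β ∈ IntermediateField.adjoin ℚ {Complex.I} ∧ Complex.I = (α : ℂ) * β ^ 4 := by
  rintro ⟨α, β, hβ, h⟩
  have key : ∃ p q : ℚ, β = (p : ℂ) + q * Complex.I := by
    clear h
    induction hβ using IntermediateField.adjoin_induction with
    | mem x hx => exact ⟨0, 1, by simpa using hx⟩
    | algebraMap r => exact ⟨r, 0, by simp⟩
    | add a b _ _ ha hb =>
      obtain ⟨p, q, rfl⟩ := ha
      obtain ⟨p', q', rfl⟩ := hb
      exact ⟨p + p', q + q', by push_cast; ring⟩
    | inv a _ ha =>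
      obtain ⟨p, q, rfl⟩ := ha
      exact exists_inv_eq_add_mul_sqrt_neg_one Complex.I_sq p q
    | mul a b _ _ ha hb =>
      obtain ⟨p, q, rfl⟩ := ha
      obtain ⟨p', q', rfl⟩ := hb
      refine ⟨p * p' - q * q', p * q' + q * p', ?_⟩
      push_cast
      linear_combination (q * q' : ℂ) * Complex.I_sq
  obtain ⟨p, q, rfl⟩ := key
  exact sqrt_neg_one_ne_mul_pow_four Complex.I_sq α p q h

noncomputable section

namespace Example

open AlgebraicGeometry Polynomial

/-! ### The ring `ℚ[x, y, y⁻¹] / (y² - x + 1)` -/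

/-- The homomorphism from `R` that is `ρ` on `ℚ` and sends `y` to a given unit `t`. -/
def liftR {S : Type*} [CommRing S] (ρ : ℚ →+* S) (t : S) (ht : IsUnit t) : R →+* S :=
  Ideal.Quotient.lift _
    (IsLocalization.Away.lift (MvPolynomial.X 1 : MvPolynomial (Fin 2) ℚ)
      (g := MvPolynomial.eval₂Hom ρ ![t ^ 2 + 1, t]) (by simpa using ht))
    (by
      intro a ha
      rw [← RingHom.mem_ker]
      revert a
      rw [← SetLike.le_def, Ideal.span_singleton_le_iff_mem, RingHom.mem_ker]
      simp [xP, yP])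

theorem liftR_y {S : Type*} [CommRing S] (ρ : ℚ →+* S) (t : S) (ht : IsUnit t) :
    liftR ρ t ht y = t := by
  rw [liftR, y, Ideal.Quotient.lift_mk, yP, IsLocalization.Away.lift_eq]
  simp

theorem liftR_x {S : Type*} [CommRing S] (ρ : ℚ →+* S) (t : S) (ht : IsUnit t) :
    liftR ρ t ht x = t ^ 2 + 1 := by
  rw [rel, map_add, map_pow, liftR_y, map_one]

/-- `y` generates `R` up to inverting it, so a homomorphism from `R` is determined by its value
at `y`. -/
theorem ringHom_ext {S : Type*} [CommRing S] {φ ψ : R →+* S} (h : φ y = ψ y) : φ = ψ := by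
  ext c
  obtain ⟨n, p, hp⟩ := exists_pow_mul c
  have e : φ.comp (aeval y : ℚ[X] →ₐ[ℚ] R).toRingHom =
      ψ.comp (aeval y : ℚ[X] →ₐ[ℚ] R).toRingHom :=
    Polynomial.ringHom_ext' (Subsingleton.elim _ _) (by simpa using h)
  have e' : φ (aeval y p) = ψ (aeval y p) := congrArg (fun r => r p) e
  rw [← hp, map_mul, map_mul, map_pow, map_pow, h] at e'
  exact ((isUnit_y.map ψ).pow n).mul_left_cancel e'

/-- Modulo `x = y² + 1` one has `y⁻¹ = -y`, and every element of `R` is linear in `y`. -/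
theorem exists_eq_add_mul_y (c : R) : ∃ (p q : ℚ) (d : R),
    c = algebraMap ℚ R p + algebraMap ℚ R q * y + x * d := by
  obtain ⟨n, P, h⟩ := exists_pow_mul c
  obtain ⟨e, he⟩ : x ∣ 1 - (y * -y) ^ n := by
    have h1 : x ∣ 1 - (y * -y) := ⟨1, by rw [rel]; ring⟩
    refine h1.trans ?_
    simpa using sub_dvd_pow_sub_pow (1 : R) (y * -y) n
  let Q : ℚ[X] := (-X) ^ n * P
  have hm : (X ^ 2 + 1 : ℚ[X]).Monic := by monicity!
  have hd : (X ^ 2 + 1 : ℚ[X]).natDegree = 2 := by compute_degree!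
  have hQ := congrArg (aeval y : ℚ[X] →ₐ[ℚ] R) (modByMonic_add_div Q (X ^ 2 + 1))
  have hlt : (Q %ₘ (X ^ 2 + 1)).natDegree < 2 := by
    have := natDegree_modByMonic_lt Q hm (by intro h0; rw [h0] at hd; simp at hd)
    rwa [hd] at this
  have hlin := congrArg (aeval y : ℚ[X] →ₐ[ℚ] R)
    (eq_X_add_C_of_natDegree_le_one (Nat.le_of_lt_succ hlt))
  refine ⟨(Q %ₘ (X ^ 2 + 1)).coeff 0, (Q %ₘ (X ^ 2 + 1)).coeff 1,
    aeval y (Q /ₘ (X ^ 2 + 1)) + e * c, ?_⟩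
  rw [map_add, hlin] at hQ
  simp only [map_add, map_mul, map_pow, aeval_X, aeval_C, map_one, map_neg, Q, ← h] at hQ ⊢
  rw [← rel] at hQ
  rw [add_comm (algebraMap ℚ R _)]
  linear_combination c * he - hQ

/-- Under a homomorphism to a field that kills `x`, the ring `R` becomes `ℚ(√-1)`. -/
theorem exists_apply_eq_add_mul {F : Type*} [Field F] [CharZero F] (φ : R →+* F)
    (hx : φ x = 0) (c : R) : ∃ p q : ℚ, φ c = (p : F) + q * φ y := by
  obtain ⟨p, q, d, rfl⟩ := exists_eq_add_mul_y c
  have hQ (r : ℚ) : φ (algebraMap ℚ R r) = r := by simp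
  exact ⟨p, q, by simp only [map_add, map_mul, hx, hQ, zero_mul, add_zero]⟩

theorem apply_y_sq {F : Type*} [CommRing F] (φ : R →+* F) (hx : φ x = 0) : φ y ^ 2 = -1 := by
  rw [rel, map_add, map_pow, map_one] at hx
  linear_combination hx

theorem x_ne_zero : x ≠ 0 := by
  intro h
  have := liftR_x (algebraMap ℚ ℚ) 1 isUnit_one
  rw [h, map_zero] at this
  norm_num at this

instance isMaximal_span_x : (Ideal.span {x}).IsMaximal := by
  rw [Ideal.isMaximal_iff]
  constructor
  · intro h
    obtain ⟨d, hd⟩ := Ideal.mem_span_singleton'.mp h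
    have := congrArg (liftR (algebraMap ℚ ℂ) Complex.I (by simp)) hd
    simp [liftR_x] at this
  · intro J c hJ hc hcJ
    obtain ⟨p, q, d, rfl⟩ := exists_eq_add_mul_y c
    have hxJ : x ∈ J := hJ (Ideal.mem_span_singleton_self x)
    have h1 : algebraMap ℚ R p + algebraMap ℚ R q * y ∈ J := by
      have := J.sub_mem hcJ (J.mul_mem_right d hxJ)
      rwa [add_sub_cancel_right] at this
    have hn : p ^ 2 + q ^ 2 ≠ 0 := by
      intro h0
      have hp : p = 0 := by nlinarith [sq_nonneg p, sq_nonneg q]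
      have hq : q = 0 := by nlinarith [sq_nonneg p, sq_nonneg q]
      apply hc
      rw [hp, hq, map_zero, zero_mul, add_zero, zero_add]
      exact Ideal.mul_mem_right _ _ (Ideal.mem_span_singleton_self x)
    have h2 := J.add_mem (J.mul_mem_left (algebraMap ℚ R p - algebraMap ℚ R q * y) h1)
      (J.mul_mem_left (algebraMap ℚ R q ^ 2) hxJ)
    have h3 : (algebraMap ℚ R p - algebraMap ℚ R q * y) *
        (algebraMap ℚ R p + algebraMap ℚ R q * y) + algebraMap ℚ R q ^ 2 * x =
        algebraMap ℚ R (p ^ 2 + q ^ 2) := by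
      rw [rel, map_add, map_pow, map_pow]
      ring
    rw [h3] at h2
    have h4 := J.mul_mem_left (algebraMap ℚ R (p ^ 2 + q ^ 2)⁻¹) h2
    rwa [← map_mul, inv_mul_cancel₀ hn, map_one] at h4

/-- The pair `(Y² - (X - 1), Y)` over `ℚ[X]`, which presents `R` as a standard étale algebra over
`ℚ[x]`. -/
def standardPair : StandardEtalePair ℚ[X] where
  f := X ^ 2 - C (X - 1)
  monic_f := by monicity!
  g := X
  cond := ⟨C (C (1 / 2)), 0, 1, by
    simp only [derivative_sub, derivative_X_pow, derivative_C]
    rw [show ((2 : ℕ) : ℚ[X]) = C 2 from rfl, sub_zero, mul_zero, add_zero, pow_one,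
      mul_right_comm, ← C_mul, ← C_mul]
    norm_num⟩

theorem hasMap_standardPair_iff {S : Type*} [CommRing S] [Algebra ℚ[X] S] (s : S) :
    standardPair.HasMap s ↔ s ^ 2 = algebraMap ℚ[X] S X - 1 ∧ IsUnit s := by
  have h1 : aeval s standardPair.f = s ^ 2 - (algebraMap ℚ[X] S X - 1) := by
    rw [standardPair, map_sub, map_pow, aeval_X, aeval_C, map_sub, map_one]
  have h2 : aeval s standardPair.g = s := aeval_X s
  rw [StandardEtalePair.HasMap, h1, h2, sub_eq_zero]

/-- The projection of `X` to the `x`-line is étale, as `d(y² + 1) = 2y dy` with `y` invertible. -/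
theorem etale_aeval_x : (aeval x : ℚ[X] →ₐ[ℚ] R).toRingHom.Etale := by
  let _ : Algebra ℚ[X] R := (aeval x : ℚ[X] →ₐ[ℚ] R).toRingHom.toAlgebra
  have hX : algebraMap ℚ[X] R X = x := by
    change aeval x X = x
    simp
  have hm : standardPair.HasMap y := by
    rw [hasMap_standardPair_iff, hX, rel, add_sub_cancel_right]
    exact ⟨rfl, isUnit_y⟩
  obtain ⟨hf, hu⟩ := (hasMap_standardPair_iff _).mp standardPair.hasMap_X
  let l : R →+* standardPair.Ring :=
    liftR ((algebraMap ℚ[X] standardPair.Ring).comp C) standardPair.X hu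
  have hl : l.comp (algebraMap ℚ[X] R) = algebraMap ℚ[X] standardPair.Ring := by
    refine Polynomial.ringHom_ext' (Subsingleton.elim _ _) ?_
    rw [RingHom.comp_apply, hX, liftR_x, hf]
    ring
  let l' : R →ₐ[ℚ[X]] standardPair.Ring :=
    { l with commutes' := fun p => congrArg (fun r => r p) hl }
  have h1 : l'.comp (standardPair.lift y hm) = AlgHom.id _ _ := by
    apply StandardEtalePair.hom_ext
    rw [AlgHom.comp_apply, StandardEtalePair.lift_X]
    exact liftR_y _ _ hu
  have h2 : ((standardPair.lift y hm).toRingHom.comp l) = RingHom.id R := by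
    apply ringHom_ext
    refine (congrArg (standardPair.lift y hm) (liftR_y _ _ hu)).trans ?_
    rw [StandardEtalePair.lift_X]
    rfl
  have hb : Function.Bijective (standardPair.lift y hm) :=
    ⟨Function.LeftInverse.injective fun c => congrArg (fun r => r c) h1,
      Function.RightInverse.surjective (g := l) fun c => congrArg (fun r => r c) h2⟩
  have : Algebra.IsStandardEtale ℚ[X] R :=
    ⟨⟨{ standardPair with x := y, hasMap := hm, lift_bijective := hb }⟩⟩
  exact (inferInstance : Algebra.Etale ℚ[X] R)

end Example

end

/-! ### Affine toric varieties of dimension one -/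

noncomputable section

namespace AffineToric

open AlgebraicGeometry

variable {k : Type} [Field k] (V : AffineToric)

variable (k) in
/-- The regular function on the toric variety given by a character in `S`. -/
def character (m : V.S) : AddMonoidAlgebra k V.S := AddMonoidAlgebra.single m 1

variable {V}

theorem character_add (m m' : V.S) :
    V.character k (m + m') = V.character k m * V.character k m' := by
  simp [character, AddMonoidAlgebra.single_mul_single]

theorem character_zero : V.character k 0 = 1 := rfl

theorem character_nsmul (d : ℕ) (m : V.S) : V.character k (d • m) = V.character k m ^ d := by
  simp [character, AddMonoidAlgebra.single_pow]

theorem exists_eq_sub (V : AffineToric) (m : Fin V.n → ℤ) : ∃ s s' : V.S, m = s - s' := by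
  have hm : m ∈ AddSubgroup.closure (V.S : Set (Fin V.n → ℤ)) := by rw [V.gen]; trivial
  induction hm using AddSubgroup.closure_induction with
  | mem x hx => exact ⟨⟨x, hx⟩, 0, by simp⟩
  | zero => exact ⟨0, 0, by simp⟩
  | add a b _ _ ha hb =>
    obtain ⟨s, s', rfl⟩ := ha
    obtain ⟨t, t', rfl⟩ := hb
    exact ⟨s + t, s' + t', by push_cast; abel⟩
  | neg a _ ha =>
    obtain ⟨s, s', rfl⟩ := ha
    exact ⟨s', s, by abel⟩

variable (k V) in
/-- The inclusion `k[S] → k[ℤⁿ]` of coordinate rings of the toric variety and its torus. -/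
abbrev toTorus : AddMonoidAlgebra k V.S →ₐ[k] AddMonoidAlgebra k (Fin V.n → ℤ) :=
  AddMonoidAlgebra.mapDomainAlgHom k k V.S.subtype

theorem toTorus_injective : Function.Injective (toTorus k V) :=
  AddMonoidAlgebra.mapDomain_injective Subtype.val_injective

theorem toTorus_character (m : V.S) :
    toTorus k V (V.character k m) = AddMonoidAlgebra.single (m : Fin V.n → ℤ) 1 := by
  simp [character]

theorem isUnit_toTorus_character (m : V.S) : IsUnit (toTorus k V (V.character k m)) := by
  rw [toTorus_character]
  refine IsUnit.of_mul_eq_one (AddMonoidAlgebra.single (-(m : Fin V.n → ℤ)) 1) ?_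
  rw [AddMonoidAlgebra.single_mul_single, add_neg_cancel, mul_one, AddMonoidAlgebra.one_def]

theorem exists_mul_character (z : AddMonoidAlgebra k (Fin V.n → ℤ)) :
    ∃ (m : V.S) (w : AddMonoidAlgebra k V.S),
      z * toTorus k V (V.character k m) = toTorus k V w := by
  induction z using AddMonoidAlgebra.induction_linear with
  | zero => exact ⟨0, 0, by simp⟩
  | add z z' hz hz' =>
    obtain ⟨m, w, h⟩ := hz
    obtain ⟨m', w', h'⟩ := hz'
    refine ⟨m + m', w * V.character k m' + w' * V.character k m, ?_⟩
    rw [character_add, map_mul, map_add, map_mul, map_mul, ← h, ← h']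
    ring
  | single m r =>
    obtain ⟨s, s', rfl⟩ := V.exists_eq_sub m
    refine ⟨s', AddMonoidAlgebra.single s r, ?_⟩
    rw [toTorus_character, AddMonoidAlgebra.single_mul_single]
    simp

variable (k V) in
/-- The multiplicative set of characters in `k[S]`. -/
def characters : Submonoid (AddMonoidAlgebra k V.S) where
  carrier := Set.range (V.character k)
  one_mem' := ⟨0, character_zero⟩
  mul_mem' := by
    rintro _ _ ⟨m, rfl⟩ ⟨m', rfl⟩
    exact ⟨m + m', character_add m m'⟩

/-- The coordinate ring of the big torus is obtained from `k[S]` by inverting the characters. -/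
theorem isLocalization_toTorus :
    letI := (toTorus k V).toRingHom.toAlgebra
    IsLocalization (characters k V) (AddMonoidAlgebra k (Fin V.n → ℤ)) := by
  let _ := (toTorus k V).toRingHom.toAlgebra
  refine ⟨?_, ?_, ?_⟩
  · rintro ⟨_, m, rfl⟩
    exact isUnit_toTorus_character m
  · intro z
    obtain ⟨m, w, h⟩ := exists_mul_character z
    exact ⟨(w, ⟨_, m, rfl⟩), h⟩
  · intro a b h
    exact ⟨1, by rw [toTorus_injective h]⟩

theorem mem_torus_iff (p : V.scheme k) :
    p ∈ V.torus k ↔ ∀ m : V.S, V.character k m ∉ (show PrimeSpectrum _ from p).asIdeal := by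
  let _ := (toTorus k V).toRingHom.toAlgebra
  have := isLocalization_toTorus (k := k) (V := V)
  have h := PrimeSpectrum.localization_comap_range (AddMonoidAlgebra k (Fin V.n → ℤ))
    (characters k V)
  have h2 : V.torus k =
    Set.range (PrimeSpectrum.comap (algebraMap _ (AddMonoidAlgebra k (Fin V.n → ℤ)))) := rfl
  rw [h2, h]
  refine Set.disjoint_left.trans ?_
  exact ⟨fun h m hm => h ⟨m, rfl⟩ hm, by rintro h _ ⟨m, rfl⟩ hm; exact h m hm⟩

/-- A toric variety whose coordinate ring embeds into a field of transcendence degree at most one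
has dimension at most one: the coordinates of the torus are algebraically independent. -/
theorem n_le_one_of_injective {K : Type} [Field K] [Algebra k K]
    (φ : AddMonoidAlgebra k V.S →ₐ[k] K) (hφ : Function.Injective φ)
    (hK : Algebra.trdeg k K ≤ 1) : V.n ≤ 1 := by
  let _ := (toTorus k V).toRingHom.toAlgebra
  have : IsScalarTower k (AddMonoidAlgebra k V.S) (AddMonoidAlgebra k (Fin V.n → ℤ)) :=
    IsScalarTower.of_algebraMap_eq fun r => ((toTorus k V).commutes r).symm
  have := isLocalization_toTorus (k := k) (V := V)
  have hu (s : characters k V) : IsUnit (φ s) := by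
    obtain ⟨_, m, rfl⟩ := s
    rw [isUnit_iff_ne_zero, Ne, map_eq_zero_iff _ hφ]
    intro (h : V.character k m = 0)
    have := isUnit_toTorus_character (k := k) m
    rw [h, map_zero] at this
    exact not_isUnit_zero this
  let ψ : AddMonoidAlgebra k (Fin V.n → ℤ) →ₐ[k] K :=
    IsLocalization.liftAlgHom (M := characters k V) (f := φ) hu
  have hψ (w : AddMonoidAlgebra k V.S) : ψ (toTorus k V w) = φ w :=
    IsLocalization.lift_eq (M := characters k V) (g := φ.toRingHom) hu w
  have hψi : Function.Injective ψ := by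
    rw [injective_iff_map_eq_zero]
    intro z hz
    obtain ⟨m, w, h⟩ := exists_mul_character z
    have h1 := congrArg ψ h
    rw [map_mul, hz, zero_mul, hψ, eq_comm, map_eq_zero_iff _ hφ] at h1
    rw [h1, map_zero] at h
    exact (isUnit_toTorus_character m).mul_left_eq_zero.mp h
  let c : (Fin V.n →₀ ℕ) →+ (Fin V.n → ℤ) :=
    { toFun := fun m i => m i
      map_zero' := rfl
      map_add' := fun a b => by ext i; simp }
  have hc : Function.Injective c := by
    intro a b h
    ext i
    exact Nat.cast_injective (R := ℤ) (congrFun h i)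
  let θ : MvPolynomial (Fin V.n) k →ₐ[k] AddMonoidAlgebra k (Fin V.n → ℤ) :=
    AddMonoidAlgebra.mapDomainAlgHom k k c
  have hθ : Function.Injective θ := AddMonoidAlgebra.mapDomain_injective hc
  have hind : AlgebraicIndependent k fun i => ψ (θ (MvPolynomial.X i)) := by
    have e : MvPolynomial.aeval (fun i => ψ (θ (MvPolynomial.X i))) = ψ.comp θ := by
      ext i
      simp
    rw [AlgebraicIndependent, e]
    exact hψi.comp hθ
  have := hind.cardinalMk_le_trdeg.trans hK
  simpa using this

/-- On a toric variety of dimension at most one with a point outside the torus, the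
characters in `S` are the multiples of a single one, which generates the ideal of that point. -/
theorem exists_generator (hn : V.n ≤ 1) (q : V.scheme k)
    (hp : q ∉ V.torus k) : ∃ e : V.S, (∀ m : V.S, ∃ d : ℕ, m = d • e) ∧
      (show PrimeSpectrum _ from q).asIdeal = Ideal.span {V.character k e} := by
  rw [mem_torus_iff] at hp
  push Not at hp
  obtain ⟨m, hm⟩ := hp
  let p : PrimeSpectrum (AddMonoidAlgebra k V.S) := q
  change V.character k m ∈ p.asIdeal at hm
  have hneg : -(m : Fin V.n → ℤ) ∉ V.S := by
    intro h
    apply p.2.ne_top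
    rw [Ideal.eq_top_iff_one, ← character_zero (V := V),
      show (0 : V.S) = m + ⟨_, h⟩ from Subtype.ext (by simp), character_add]
    exact p.asIdeal.mul_mem_right _ hm
  have hm0 : (m : Fin V.n → ℤ) ≠ 0 := by
    intro h
    exact hneg (by rw [h, neg_zero]; exact V.S.zero_mem)
  obtain ⟨i, hi⟩ := Function.ne_iff.mp hm0
  have hone (j : Fin V.n) : j = i := by
    ext
    have := j.2
    have := i.2
    omega
  let σ : Fin V.n → ℤ := fun _ => (m.1 i).sign
  have hσ (s : Fin V.n → ℤ) (d : ℕ) (h : s i = d * (m.1 i).sign) : s = d • σ := by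
    ext j
    rw [hone j]
    simpa [σ] using h
  have hss : (m.1 i).sign * (m.1 i).sign = 1 := by
    rcases lt_or_gt_of_ne hi with h0 | h0
    · simp [Int.sign_eq_neg_one_of_neg h0]
    · simp [Int.sign_eq_one_of_pos h0]
  have hpos : 0 < (m.1 i).natAbs := Int.natAbs_pos.mpr hi
  have hmσ : m.1 = (m.1 i).natAbs • σ := hσ _ _ (by rw [mul_comm, Int.sign_mul_natAbs])
  have hσS : σ ∈ V.S := V.saturated _ _ hpos (hmσ ▸ m.2)
  have hgen (s : V.S) : ∃ d : ℕ, s = d • (⟨σ, hσS⟩ : V.S) := by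
    rcases le_or_gt 0 (s.1 i * (m.1 i).sign) with h | h
    · refine ⟨(s.1 i * (m.1 i).sign).toNat, Subtype.ext ?_⟩
      refine hσ _ _ ?_
      rw [Int.toNat_of_nonneg h, mul_assoc, hss, mul_one]
    · exfalso
      have hs : s.1 = (-(s.1 i * (m.1 i).sign)).toNat • (-σ) := by
        rw [smul_neg, ← neg_eq_iff_eq_neg]
        refine hσ _ _ ?_
        rw [Int.toNat_of_nonneg (by omega), neg_mul, mul_assoc, hss, mul_one]
        rfl
      have hσ' : -σ ∈ V.S := V.saturated (-(s.1 i * (m.1 i).sign)).toNat _ (by omega) (hs ▸ s.2)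
      apply hneg
      rw [hmσ, ← smul_neg]
      exact V.S.nsmul_mem hσ' _
  refine ⟨⟨σ, hσS⟩, hgen, ?_⟩
  obtain ⟨d, hd⟩ := hgen m
  have hσp : V.character k ⟨σ, hσS⟩ ∈ p.asIdeal := by
    rw [hd, character_nsmul] at hm
    exact p.2.mem_of_pow_mem _ hm
  have key (c : AddMonoidAlgebra k V.S) : ∃ (r : k) (w : AddMonoidAlgebra k V.S),
      c = algebraMap k _ r + V.character k ⟨σ, hσS⟩ * w := by
    induction c using AddMonoidAlgebra.induction_linear with
    | zero => exact ⟨0, 0, by simp⟩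
    | add z z' hz hz' =>
      obtain ⟨r, w, rfl⟩ := hz
      obtain ⟨r', w', rfl⟩ := hz'
      exact ⟨r + r', w + w', by rw [map_add]; ring⟩
    | single s r =>
      obtain ⟨d, rfl⟩ := hgen s
      have e : AddMonoidAlgebra.single (d • (⟨σ, hσS⟩ : V.S)) r =
          algebraMap k _ r * V.character k ⟨σ, hσS⟩ ^ d := by
        rw [← character_nsmul, character]
        simp
      rw [e]
      cases d with
      | zero => exact ⟨r, 0, by simp⟩
      | succ d => exact ⟨0, algebraMap k _ r * V.character k ⟨σ, hσS⟩ ^ d, by rw [map_zero]; ring⟩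
  refine le_antisymm (fun c hc => ?_) ((Ideal.span_singleton_le_iff_mem _).mpr hσp)
  obtain ⟨r, w, rfl⟩ := key c
  have hr : algebraMap k (AddMonoidAlgebra k V.S) r ∈ p.asIdeal := by
    have := p.asIdeal.sub_mem hc (p.asIdeal.mul_mem_right w hσp)
    rwa [add_sub_cancel_right] at this
  have hr0 : r = 0 := by
    by_contra h0
    exact p.2.ne_top (Ideal.eq_top_of_isUnit_mem _ hr ((isUnit_iff_ne_zero.mpr h0).map _))
  rw [hr0, map_zero, zero_add]
  exact Ideal.mul_mem_right _ _ (Ideal.mem_span_singleton_self _)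

/-- The affine line as a toric variety. -/
def affineLine : AffineToric where
  n := 1
  S :=
    { carrier := {m | 0 ≤ m 0}
      zero_mem' := le_refl (0 : ℤ)
      add_mem' := fun {a b} (ha : 0 ≤ a 0) (hb : 0 ≤ b 0) => add_nonneg ha hb }
  fg := by
    refine ⟨{fun _ => 1}, le_antisymm ?_ ?_⟩
    · rw [AddSubmonoid.closure_le]
      intro m hm
      rw [Finset.coe_singleton, Set.mem_singleton_iff] at hm
      subst hm
      exact zero_le_one (α := ℤ)
    · intro m (hm : 0 ≤ m 0)
      have e : m = (m 0).toNat • fun _ => (1 : ℤ) := by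
        ext i
        rw [Subsingleton.elim i 0]
        simp [hm]
      rw [e]
      exact AddSubmonoid.nsmul_mem _ (AddSubmonoid.subset_closure (by simp)) _
  gen := by
    rw [eq_top_iff]
    intro m _
    have e : m = m 0 • fun _ => (1 : ℤ) := by
      ext i
      rw [Subsingleton.elim i 0]
      simp
    rw [e]
    refine AddSubgroup.zsmul_mem _ (AddSubgroup.subset_closure ?_) _
    exact zero_le_one (α := ℤ)
  saturated := by
    intro d m hd (h : 0 ≤ (d • m) 0)
    change 0 ≤ m 0
    rw [Pi.smul_apply, nsmul_eq_mul] at h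
    exact nonneg_of_mul_nonneg_right h (by exact_mod_cast hd)

/-- The characters regular on the affine line are the powers of the coordinate. -/
def affineLineEquiv : affineLine.S ≃+ ℕ where
  toFun m := (m.1 (0 : Fin 1)).toNat
  invFun d := ⟨fun _ => d, Int.natCast_nonneg d⟩
  left_inv m := Subtype.ext (funext fun i => by
    rw [show i = (0 : Fin 1) from Subsingleton.elim (α := Fin 1) i 0]
    exact Int.toNat_of_nonneg m.2)
  right_inv d := rfl
  map_add' a b := Int.toNat_add a.2 b.2

variable (k) in
/-- The coordinate ring of the affine line is the polynomial ring. -/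
def affineLineAlgEquiv : AddMonoidAlgebra k affineLine.S ≃ₐ[k] Polynomial k :=
  (AddMonoidAlgebra.domCongr k k affineLineEquiv).trans (Polynomial.toFinsuppIsoAlg k).symm

theorem affineLineAlgEquiv_character (m : affineLine.S) :
    affineLineAlgEquiv k (affineLine.character k m) = Polynomial.X ^ affineLineEquiv m := by
  rw [affineLineAlgEquiv, AlgEquiv.trans_apply, character, AddMonoidAlgebra.domCongr_single,
    AlgEquiv.symm_apply_eq]
  simp

end AffineToric

end

/-! ### Functions pulled back to a stalk along a morphism to an affine scheme -/

noncomputable section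

namespace AlgebraicGeometry

variable {Y : Scheme.{0}} {A : Type} [CommRing A]

/-- For a morphism `h : Y → Spec A`, the homomorphism from `A` to the local ring at `y`. -/
def pointHom (h : Y ⟶ Spec (CommRingCat.of A)) (y : Y) : A →+* Y.presheaf.stalk y :=
  ((Scheme.ΓSpecIso (CommRingCat.of A)).inv ≫ h.appTop ≫
    Y.presheaf.germ ⊤ y (TopologicalSpace.Opens.mem_top _)).hom

theorem pointHom_comp {Z : Scheme.{0}} (g : Z ⟶ Y) (h : Y ⟶ Spec (CommRingCat.of A)) (z : Z) :
    pointHom (g ≫ h) z = (g.stalkMap z).hom.comp (pointHom h (g z)) := by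
  have e := Scheme.Hom.germ_stalkMap g ⊤ z (TopologicalSpace.Opens.mem_top _)
  rw [pointHom, pointHom, ← CommRingCat.hom_comp]
  simp only [Category.assoc, e, Scheme.Hom.comp_appTop]
  rfl

theorem pointHom_SpecMap {B : Type} [CommRing B] (h : Y ⟶ Spec (CommRingCat.of B)) (α : A →+* B)
    (y : Y) : pointHom (h ≫ Spec.map (CommRingCat.ofHom α)) y = (pointHom h y).comp α := by
  have e := Scheme.ΓSpecIso_inv_naturality (CommRingCat.ofHom α)
  rw [pointHom, pointHom, Scheme.Hom.comp_appTop, Category.assoc, ← Category.assoc, ← e]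
  rfl

/-- The homomorphism from `A` to the local ring of `Spec A` at a point. -/
def specStalk (p : Spec (CommRingCat.of A)) : A →+* (Spec (CommRingCat.of A)).presheaf.stalk p :=
  (StructureSheaf.toStalk A p).hom

theorem pointHom_id (p : Spec (CommRingCat.of A)) :
    pointHom (𝟙 (Spec (CommRingCat.of A))) p = specStalk p := by
  rw [pointHom]
  simp
  rfl

theorem pointHom_eq (h : Y ⟶ Spec (CommRingCat.of A)) (y : Y) :
    pointHom h y = (h.stalkMap y).hom.comp (specStalk (h y)) := by
  conv_lhs => rw [← Category.comp_id h]
  rw [pointHom_comp, pointHom_id]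

/-- The prime ideal of `A` corresponding to a point of `Spec A`. -/
abbrev pointIdeal (p : Spec (CommRingCat.of A)) : Ideal A := (show PrimeSpectrum A from p).asIdeal

theorem isLocalization_specStalk (p : Spec (CommRingCat.of A)) :
    letI := (specStalk p).toAlgebra
    IsLocalization.AtPrime ((Spec (CommRingCat.of A)).presheaf.stalk p) (pointIdeal p) :=
  StructureSheaf.IsLocalization.to_stalk A p

theorem pointHom_mem_maximalIdeal_iff (h : Y ⟶ Spec (CommRingCat.of A)) (y : Y) (c : A) :
    pointHom h y c ∈ IsLocalRing.maximalIdeal (Y.presheaf.stalk y) ↔ c ∈ pointIdeal (h y) := by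
  let _ := (specStalk (h y)).toAlgebra
  have := isLocalization_specStalk (h y)
  rw [pointHom_eq, RingHom.comp_apply, IsLocalRing.mem_maximalIdeal, mem_nonunits_iff,
    isUnit_map_iff, ← mem_nonunits_iff, ← IsLocalRing.mem_maximalIdeal]
  exact IsLocalization.AtPrime.to_map_mem_maximal_iff _ (pointIdeal (h y)) c

/-- A morphism of finite type that is unramified generates the maximal ideals of local rings by
those of the target. -/
theorem map_pointIdeal (h : Y ⟶ Spec (CommRingCat.of A)) [FormallyUnramified h]
    [LocallyOfFiniteType h] (y : Y) :
    (pointIdeal (h y)).map (pointHom h y) = IsLocalRing.maximalIdeal (Y.presheaf.stalk y) := by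
  let _ := (specStalk (h y)).toAlgebra
  have := isLocalization_specStalk (h y)
  rw [pointHom_eq, ← Ideal.map_map]
  have e : (pointIdeal (h y)).map (specStalk (h y)) =
      IsLocalRing.maximalIdeal ((Spec (CommRingCat.of A)).presheaf.stalk (h y)) :=
    IsLocalization.AtPrime.map_eq_maximalIdeal (pointIdeal (h y)) _
  rw [e]
  algebraize [(h.stalkMap y).hom]
  have : IsLocalHom (algebraMap ((Spec (CommRingCat.of A)).presheaf.stalk (h y))
      (Y.presheaf.stalk y)) := inferInstanceAs <| IsLocalHom (h.stalkMap y).hom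
  have : Algebra.EssFiniteType ((Spec (CommRingCat.of A)).presheaf.stalk (h y))
      (Y.presheaf.stalk y) := by
    rw [← RingHom.essFiniteType_algebraMap, RingHom.algebraMap_toAlgebra]
    exact LocallyOfFiniteType.stalkMap h y
  have : Algebra.FormallyUnramified ((Spec (CommRingCat.of A)).presheaf.stalk (h y))
      (Y.presheaf.stalk y) := by
    rw [← RingHom.formallyUnramified_algebraMap, RingHom.algebraMap_toAlgebra]
    exact FormallyUnramified.stalkMap h y
  exact Algebra.FormallyUnramified.map_maximalIdeal

theorem specStalk_mem_maximalIdeal_iff (p : Spec (CommRingCat.of A)) (c : A) :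
    specStalk p c ∈ IsLocalRing.maximalIdeal ((Spec (CommRingCat.of A)).presheaf.stalk p) ↔
      c ∈ pointIdeal p := by
  have h := pointHom_mem_maximalIdeal_iff (𝟙 (Spec (CommRingCat.of A))) p c
  rwa [pointHom_id] at h

theorem map_specStalk_pointIdeal (p : Spec (CommRingCat.of A)) :
    (pointIdeal p).map (specStalk p) =
      IsLocalRing.maximalIdeal ((Spec (CommRingCat.of A)).presheaf.stalk p) := by
  have h := map_pointIdeal (𝟙 (Spec (CommRingCat.of A))) p
  rwa [pointHom_id] at h

theorem pointHom_injective [IsDomain A] (h : Y ⟶ Spec (CommRingCat.of A)) [Flat h] (y : Y) :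
    Function.Injective (pointHom h y) := by
  have hf : (pointHom h y).Flat := by
    rw [pointHom_eq]
    refine RingHom.Flat.comp ?_ (Flat.stalkMap h y)
    let _ := (specStalk (h y)).toAlgebra
    have := isLocalization_specStalk (h y)
    exact IsLocalization.flat ((Spec (CommRingCat.of A)).presheaf.stalk (h y))
      (pointIdeal (h y)).primeCompl
  algebraize [pointHom h y]
  exact FaithfulSMul.algebraMap_injective A (Y.presheaf.stalk y)

theorem pointHom_stalkSpecializes (h : Y ⟶ Spec (CommRingCat.of A)) {y y' : Y} (hy : y ⤳ y') :
    (Y.presheaf.stalkSpecializes hy).hom.comp (pointHom h y') = pointHom h y := by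
  rw [pointHom, pointHom, ← CommRingCat.hom_comp, Category.assoc, Category.assoc,
    TopCat.Presheaf.germ_stalkSpecializes]

theorem specStalk_stalkSpecializes {p q : Spec (CommRingCat.of A)} (h : q ⤳ p) :
    ((Spec (CommRingCat.of A)).presheaf.stalkSpecializes h).hom.comp (specStalk p) =
      specStalk q := by
  rw [← pointHom_id, ← pointHom_id, pointHom_stalkSpecializes]

theorem stalkMap_specStalk {B : Type} [CommRing B] (α : A →+* B) (p : Spec (CommRingCat.of B)) :
    ((Spec.map (CommRingCat.ofHom α)).stalkMap p).hom.comp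
      (specStalk (Spec.map (CommRingCat.ofHom α) p)) = (specStalk p).comp α := by
  have h1 := pointHom_comp (Spec.map (CommRingCat.ofHom α)) (𝟙 _) p
  have h2 := pointHom_SpecMap (𝟙 (Spec (CommRingCat.of B))) α p
  rw [Category.id_comp] at h2
  rw [Category.comp_id, h2, pointHom_id, pointHom_id] at h1
  exact h1.symm

theorem specStalk_injective [IsDomain A] (p : Spec (CommRingCat.of A)) :
    Function.Injective (specStalk p) := by
  rw [← pointHom_id]
  exact pointHom_injective _ p

theorem exists_specStalk_mul_eq (p : Spec (CommRingCat.of A))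
    (o : (Spec (CommRingCat.of A)).presheaf.stalk p) :
    ∃ c s : A, IsUnit (specStalk p s) ∧ o * specStalk p s = specStalk p c := by
  let _ := (specStalk p).toAlgebra
  have := isLocalization_specStalk p
  obtain ⟨⟨c, s⟩, h⟩ := IsLocalization.surj (pointIdeal p).primeCompl o
  exact ⟨c, s, IsLocalization.map_units _ s, h⟩

theorem isNoetherianRing_stalk_Spec [IsNoetherianRing A] (p : Spec (CommRingCat.of A)) :
    IsNoetherianRing ((Spec (CommRingCat.of A)).presheaf.stalk p) := by
  let _ := (specStalk p).toAlgebra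
  have := isLocalization_specStalk p
  exact IsLocalization.isNoetherianRing (pointIdeal p).primeCompl _ inferInstance

theorem trdeg_stalk_le_one [IsIntegral Y] (h : Y ⟶ Spec (CommRingCat.of (Polynomial ℚ))) [Etale h]
    [Algebra ℚ (Y.presheaf.stalk (genericPoint Y))] :
    Algebra.trdeg ℚ (Y.presheaf.stalk (genericPoint Y)) ≤ 1 := by
  have hi := pointHom_injective h (genericPoint Y)
  have hu : (pointHom h (genericPoint Y)).FormallyUnramified := by
    rw [pointHom_eq]
    refine RingHom.FormallyUnramified.comp ?_ (FormallyUnramified.stalkMap h (genericPoint Y))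
    let _ := (specStalk (h (genericPoint Y))).toAlgebra
    have := isLocalization_specStalk (h (genericPoint Y))
    exact Algebra.FormallyUnramified.of_isLocalization (pointIdeal (h (genericPoint Y))).primeCompl
  have he : (pointHom h (genericPoint Y)).EssFiniteType := by
    rw [pointHom_eq]
    refine RingHom.EssFiniteType.comp ?_ (LocallyOfFiniteType.stalkMap h (genericPoint Y))
    let _ := (specStalk (h (genericPoint Y))).toAlgebra
    have := isLocalization_specStalk (h (genericPoint Y))
    exact Algebra.EssFiniteType.of_isLocalization _ (pointIdeal (h (genericPoint Y))).primeCompl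
  algebraize [pointHom h (genericPoint Y)]
  have : FaithfulSMul (Polynomial ℚ) Y.functionField :=
    (faithfulSMul_iff_algebraMap_injective _ _).mpr hi
  let F := FractionRing (Polynomial ℚ)
  let _ : Algebra F Y.functionField := FractionRing.liftAlgebra (Polynomial ℚ) Y.functionField
  have : IsScalarTower (Polynomial ℚ) F Y.functionField := inferInstance
  have : Algebra.FormallyUnramified F Y.functionField :=
    Algebra.FormallyUnramified.of_restrictScalars (Polynomial ℚ) F Y.functionField
  have : Algebra.EssFiniteType F Y.functionField :=
    Algebra.EssFiniteType.of_comp (Polynomial ℚ) F Y.functionField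
  have : Algebra.IsSeparable F Y.functionField := Algebra.FormallyUnramified.isSeparable F _
  have : Algebra.IsAlgebraic (Polynomial ℚ) Y.functionField :=
    (IsFractionRing.comap_isAlgebraic_iff (A := Polynomial ℚ) (K := F)).mpr inferInstance
  have : IsScalarTower ℚ (Polynomial ℚ) Y.functionField :=
    IsScalarTower.of_algebraMap_eq' (Subsingleton.elim _ _)
  have e := trdeg_add_eq ℚ (Polynomial ℚ) (A := Y.functionField)
  rw [Polynomial.trdeg_of_isDomain, trdeg_eq_zero, add_zero] at e
  exact e.symm.le

/-- Over `ℚ`, an étale morphism from an integral curve to an affine toric variety exists only if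
the latter is of dimension at most one. Being a curve is expressed by an étale map to the line. -/
theorem toric_n_le_one_of_etale [IsIntegral Y]
    (h : Y ⟶ Spec (CommRingCat.of (Polynomial ℚ))) [Etale h] {T : AffineToric}
    (φ : Y ⟶ T.scheme ℚ) [Etale φ] : T.n ≤ 1 := by
  let _ : Algebra ℚ (Y.presheaf.stalk (genericPoint Y)) :=
    ((pointHom h (genericPoint Y)).comp Polynomial.C).toAlgebra
  have : IsDomain (AddMonoidAlgebra ℚ T.S) := (AffineToric.toTorus_injective).isDomain
  have : Flat (Y := Spec (CommRingCat.of (AddMonoidAlgebra ℚ T.S))) φ :=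
    (Etale.iff_flat_and_formallyUnramified.mp ‹Etale φ›).1
  have hφ := pointHom_injective (A := AddMonoidAlgebra ℚ T.S) φ
  exact AffineToric.n_le_one_of_injective
    (K := Y.functionField) (RingHom.toRatAlgHom (pointHom φ (genericPoint Y)))
    (hφ _) (trdeg_stalk_le_one h)

end AlgebraicGeometry

end

/-! ### Strict toroidal embeddings given by one function on an affine variety -/

noncomputable section

namespace Example

open AlgebraicGeometry Polynomial

/-- The homomorphism `ℚ[S] → A`, for `S` the characters of the affine line, that sends the
coordinate to `t`. -/
def lineHom {A : Type} [CommRing A] [Algebra ℚ A] (t : A) :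
    AddMonoidAlgebra ℚ AffineToric.affineLine.S →ₐ[ℚ] A :=
  (aeval t : ℚ[X] →ₐ[ℚ] A).comp (AffineToric.affineLineAlgEquiv ℚ)

theorem lineHom_character {A : Type} [CommRing A] [Algebra ℚ A] (t : A)
    (m : AffineToric.affineLine.S) : lineHom t (AffineToric.affineLine.character ℚ m) =
      t ^ AffineToric.affineLineEquiv m := by
  rw [lineHom, AlgHom.comp_apply, AlgEquiv.coe_toAlgHom, AffineToric.affineLineAlgEquiv_character,
    map_pow, aeval_X]

theorem etale_SpecMap_lineHom {A : Type} [CommRing A] [Algebra ℚ A] {t : A}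
    (ht : (aeval t : ℚ[X] →ₐ[ℚ] A).toRingHom.Etale) :
    Etale (Spec.map (CommRingCat.ofHom (lineHom t).toRingHom)) :=
  (HasRingHomProperty.Spec_iff (P := @Etale)).mpr (RingHom.Etale.stableUnderComposition _ _
    (RingHom.Etale.of_bijective (AffineToric.affineLineAlgEquiv ℚ).bijective) ht)

section Affine

variable {A : Type} [CommRing A] [IsDomain A] [Algebra ℚ A] [Algebra.FiniteType ℚ A]

/-- The open subset of an affine variety where the function `t` does not vanish. -/
abbrev nonvanishing (t : A) : (affineVariety A).X.Opens := PrimeSpectrum.basicOpen t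

theorem mem_nonvanishing {t : A} {p : (affineVariety A).X} :
    p ∈ nonvanishing t ↔ t ∉ pointIdeal p := Iff.rfl

/-- A function `t` that is an étale map to the affine line is a chart for its nonvanishing locus
at every point. -/
def lineChart (t : A) (ht : (aeval t : ℚ[X] →ₐ[ℚ] A).toRingHom.Etale) (p : (affineVariety A).X) :
    EtaleChart (affineVariety A) (nonvanishing t) p where
  T := AffineToric.affineLine
  W := ⊤
  mem := trivial
  φ := (⊤ : (affineVariety A).X.Opens).ι ≫ Spec.map (CommRingCat.ofHom (lineHom t).toRingHom)
  w := by
    have h : Spec.map (CommRingCat.ofHom (lineHom t).toRingHom) ≫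
        Spec.map (CommRingCat.ofHom (algebraMap ℚ _)) =
          Spec.map (CommRingCat.ofHom (algebraMap ℚ A)) := by
      rw [← Spec.map_comp, ← CommRingCat.ofHom_comp]
      congr 2
      exact (lineHom t).comp_algebraMap
    refine (Category.assoc (⊤ : (affineVariety A).X.Opens).ι (Spec.map _) (Spec.map _)).trans ?_
    exact congrArg ((⊤ : (affineVariety A).X.Opens).ι ≫ ·) h
  etale :=
    have := etale_SpecMap_lineHom ht
    Etale.etale_comp (Y := Spec (CommRingCat.of A)) (⊤ : (Spec (CommRingCat.of A)).Opens).ι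
      (Spec.map (CommRingCat.ofHom (lineHom t).toRingHom))
  preimage_torus := by
    refine ⟨⊤, trivial, fun q _ => ?_⟩
    rw [mem_nonvanishing, AffineToric.mem_torus_iff]
    set P : Ideal A := pointIdeal ((⊤ : (affineVariety A).X.Opens).ι q)
    have hP : P.IsPrime := PrimeSpectrum.isPrime _
    change t ∉ P ↔ ∀ m : AffineToric.affineLine.S, lineHom t (AffineToric.affineLine.character ℚ m) ∉ P
    constructor
    · intro h m hm
      rw [lineHom_character] at hm
      exact h (hP.mem_of_pow_mem _ hm)
    · intro h ht
      refine h (AffineToric.affineLineEquiv.symm 1) ?_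
      rwa [lineHom_character, AddEquiv.apply_symm_apply, pow_one]

/-- The point of an affine variety given by a maximal ideal `(t)`. -/
def pt (t : A) (ht : (Ideal.span {t}).IsMaximal) : (affineVariety A).X :=
  (⟨Ideal.span {t}, ht.isPrime⟩ : PrimeSpectrum A)

theorem eq_pt_of_mem {t : A} (ht : (Ideal.span {t}).IsMaximal) {p : (affineVariety A).X}
    (hp : t ∈ pointIdeal p) : p = pt t ht := by
  refine PrimeSpectrum.ext ?_
  exact (ht.eq_of_le (PrimeSpectrum.isPrime _).ne_top
    ((Ideal.span_singleton_le_iff_mem _).mpr hp)).symm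

theorem compl_nonvanishing {t : A} (ht : (Ideal.span {t}).IsMaximal) :
    (nonvanishing t : Set (affineVariety A).X)ᶜ = {pt t ht} := by
  ext p
  rw [Set.mem_compl_iff, SetLike.mem_coe, mem_nonvanishing, not_not, Set.mem_singleton_iff]
  refine ⟨eq_pt_of_mem ht, ?_⟩
  rintro rfl
  exact Ideal.mem_span_singleton_self t

theorem isClosed_pt {t : A} (ht : (Ideal.span {t}).IsMaximal) : IsClosed {pt t ht} :=
  (PrimeSpectrum.isClosed_singleton_iff_isMaximal _).mpr ht

theorem localIdeal_singleton {X : Scheme.{0}} (p : X) :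
    localIdeal {p} p = IsLocalRing.maximalIdeal (X.presheaf.stalk p) := by
  have h : (X.fromSpecStalk p ⁻¹' {p} : Set (PrimeSpectrum (X.presheaf.stalk p))) =
      {IsLocalRing.closedPoint (X.presheaf.stalk p)} := by
    ext q
    constructor
    · intro hq
      exact (X.fromSpecStalk p).isEmbedding.injective (hq.trans Scheme.fromSpecStalk_closedPoint.symm)
    · rintro rfl
      exact Scheme.fromSpecStalk_closedPoint
  exact (congrArg PrimeSpectrum.vanishingIdeal h).trans (PrimeSpectrum.vanishingIdeal_singleton _)

theorem isStrictToroidal_nonvanishing {t : A} (het : (aeval t : ℚ[X] →ₐ[ℚ] A).toRingHom.Etale)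
    (ht : (Ideal.span {t}).IsMaximal) : IsStrictToroidal (affineVariety A) (nonvanishing t) := by
  refine ⟨fun p _ => ⟨lineChart t het p⟩, ?_⟩
  rintro Z ⟨⟨hZ, hZD⟩, -⟩ p hp
  rw [compl_nonvanishing ht] at hZD
  have hZp : Z = {p} := by
    refine Set.eq_singleton_iff_unique_mem.mpr ⟨hp, fun q hq => ?_⟩
    exact (hZD hq).trans (hZD hp).symm
  rw [hZp, localIdeal_singleton]
  let _ := Ideal.Quotient.field
    (IsLocalRing.maximalIdeal ((affineVariety A).X.presheaf.stalk p))
  exact ⟨inferInstance, inferInstance⟩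

theorem germ_mem_maximalIdeal_iff (p : (affineVariety A).X) (c : A) :
    germ p c ∈ IsLocalRing.maximalIdeal ((affineVariety A).X.presheaf.stalk p) ↔
      c ∈ pointIdeal p :=
  specStalk_mem_maximalIdeal_iff p c

theorem maximalIdeal_stalk_pt {t : A} (ht : (Ideal.span {t}).IsMaximal) :
    IsLocalRing.maximalIdeal ((affineVariety A).X.presheaf.stalk (pt t ht)) =
      Ideal.span {germ (pt t ht) t} := by
  refine (map_specStalk_pointIdeal (A := A) (pt t ht)).symm.trans ?_
  change Ideal.map _ (Ideal.span {t}) = _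
  rw [Ideal.map_span, Set.image_singleton]
  rfl

theorem localIdeal_compl_nonvanishing {t : A} (ht : (Ideal.span {t}).IsMaximal)
    (p : (affineVariety A).X) :
    localIdeal (nonvanishing t : Set (affineVariety A).X)ᶜ p = Ideal.span {germ p t} := by
  by_cases hp : t ∈ pointIdeal p
  · obtain rfl := eq_pt_of_mem ht hp
    rw [compl_nonvanishing ht, localIdeal_singleton, maximalIdeal_stalk_pt]
  · have hu : IsUnit (germ p t) := by
      by_contra h
      exact hp ((germ_mem_maximalIdeal_iff p t).mp h)
    have he : ((affineVariety A).X.fromSpecStalk p ⁻¹' (nonvanishing t : Set (affineVariety A).X)ᶜ :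
        Set (PrimeSpectrum ((affineVariety A).X.presheaf.stalk p))) = ∅ := by
      rw [Set.eq_empty_iff_forall_notMem]
      intro q hq
      refine hq ?_
      have hs : (affineVariety A).X.fromSpecStalk p q ⤳ p := by
        have : (affineVariety A).X.fromSpecStalk p q ∈
            Set.range ((affineVariety A).X.fromSpecStalk p) := ⟨q, rfl⟩
        rwa [Scheme.range_fromSpecStalk] at this
      exact hs.mem_open (nonvanishing t).isOpen hp
    refine (congrArg PrimeSpectrum.vanishingIdeal he).trans ?_
    rw [PrimeSpectrum.vanishingIdeal_empty, eq_comm, Ideal.span_singleton_eq_top]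
    exact hu

end Affine

/-! ### The points `a` and `b` -/

instance isMaximal_span_X : (Ideal.span {(X : ℚ[X])}).IsMaximal :=
  PrincipalIdealRing.isMaximal_of_irreducible irreducible_X

/-- The point `x = 0` of `X`. -/
def a : curve.X := pt x isMaximal_span_x

theorem mem_pointIdeal_f (p : curve.X) : (X : ℚ[X]) ∈ pointIdeal (f.hom p) ↔ x ∈ pointIdeal p := by
  have hp : (pointIdeal p).IsPrime := PrimeSpectrum.isPrime _
  change aeval (y * x ^ 4) (X : ℚ[X]) ∈ pointIdeal p ↔ _
  rw [aeval_X]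
  constructor
  · intro h
    refine hp.mem_of_pow_mem 4 ((hp.mem_or_mem h).resolve_left fun hy => ?_)
    exact hp.ne_top (Ideal.eq_top_of_isUnit_mem _ hy isUnit_y)
  · intro h
    exact Ideal.mul_mem_left _ _ (Ideal.pow_mem_of_mem _ h 4 (by norm_num))

theorem f_eq_b_iff (p : curve.X) : f.hom p = b ↔ p = a := by
  constructor
  · intro h
    refine eq_pt_of_mem _ ((mem_pointIdeal_f p).mp ?_)
    rw [h]
    exact Ideal.mem_span_singleton_self _
  · rintro rfl
    refine eq_pt_of_mem isMaximal_span_X ((mem_pointIdeal_f a).mpr ?_)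
    exact Ideal.mem_span_singleton_self _

theorem isClosed_a : IsClosed {a} := isClosed_pt _

theorem isStrictToroidal_curve : IsStrictToroidal curve curveU :=
  isStrictToroidal_nonvanishing etale_aeval_x isMaximal_span_x

theorem isStrictToroidal_line : IsStrictToroidal line lineU :=
  isStrictToroidal_nonvanishing (t := (X : ℚ[X])) (by
    have e : (aeval (X : ℚ[X]) : ℚ[X] →ₐ[ℚ] ℚ[X]).toRingHom = RingHom.id _ := by
      ext <;> simp
    rw [e]
    exact RingHom.Etale.containsIdentities _) isMaximal_span_X

theorem curveU_le : curveU ≤ f.hom ⁻¹ᵁ lineU := fun p hp h => hp ((mem_pointIdeal_f p).mp h)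

/-- The function `y x⁴ = T (T² + 1)⁴` is transcendental over `ℚ`, as it is not constant. -/
theorem aeval_injective : Function.Injective (aeval (y * x ^ 4) : ℚ[X] →ₐ[ℚ] R) := by
  let P : ℚ[X] := X * (X ^ 2 + 1) ^ 4
  have hP : toRatFunc (y * x ^ 4) = algebraMap ℚ[X] (FractionRing ℚ[X]) P := by
    rw [rel, map_mul, map_pow, map_add, map_pow, toRatFunc_y, map_one]
    simp [P]
  rw [injective_iff_map_eq_zero]
  intro p hp
  have e : toRatFunc.comp (aeval (y * x ^ 4) : ℚ[X] →ₐ[ℚ] R).toRingHom =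
      (algebraMap ℚ[X] (FractionRing ℚ[X])).comp (compRingHom P) := by
    refine Polynomial.ringHom_ext' (Subsingleton.elim _ _) ?_
    have h1 : (aeval (y * x ^ 4) : ℚ[X] →ₐ[ℚ] R).toRingHom X = y * x ^ 4 := aeval_X _
    rw [RingHom.comp_apply, h1, hP, RingHom.comp_apply, coe_compRingHom_apply, X_comp]
  have e' : toRatFunc (aeval (y * x ^ 4) p) = algebraMap ℚ[X] (FractionRing ℚ[X]) (p.comp P) :=
    congrArg (fun r => r p) e
  rw [hp, map_zero, eq_comm, map_eq_zero_iff _ (IsFractionRing.injective _ _),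
    comp_eq_zero_iff] at e'
  refine e'.resolve_right fun h => ?_
  have h1 := congrArg (eval 1) h.2
  simp [P] at h1

instance isDominant_f : IsDominant f.hom :=
  ⟨(PrimeSpectrum.denseRange_comap_iff_ker_le_nilRadical _).mpr (by
    have h : RingHom.ker (aeval (y * x ^ 4) : ℚ[X] →ₐ[ℚ] R).toRingHom = ⊥ :=
      (RingHom.injective_iff_ker_eq_bot _).mp aeval_injective
    exact h.le.trans bot_le)⟩

end Example

end

/-! ### Logarithmic differential forms of the example -/

noncomputable section

section Derivation

variable {k K O : Type} [Field k] [Field K] [Algebra k K] [CommRing O] [Algebra O K]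
  (M : Submodule O Ω[K⁄k])

/-- The elements of `O` whose differential lies in a given `O`-module of differential forms. -/
def integrableSubring : Subring O where
  carrier := {o | KaehlerDifferential.D k K (algebraMap O K o) ∈ M}
  mul_mem' {a b} ha hb := by
    simp only [Set.mem_ofPred_eq] at ha hb ⊢
    rw [map_mul, Derivation.leibniz, ← algebra_compatible_smul, ← algebra_compatible_smul]
    exact M.add_mem (M.smul_mem a hb) (M.smul_mem b ha)
  one_mem' := by simp
  add_mem' {a b} ha hb := by
    simp only [Set.mem_ofPred_eq] at ha hb ⊢
    rw [map_add, map_add]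
    exact M.add_mem ha hb
  zero_mem' := by simp
  neg_mem' {a} ha := by
    simp only [Set.mem_ofPred_eq] at ha ⊢
    rw [map_neg, map_neg]
    exact M.neg_mem ha

variable {M}

theorem mem_integrableSubring {o : O} :
    o ∈ integrableSubring M ↔ KaehlerDifferential.D k K (algebraMap O K o) ∈ M := Iff.rfl

theorem mem_integrableSubring_of_mul_mem {o s : O} (hs : IsUnit s)
    (h1 : s ∈ integrableSubring M) (h2 : o * s ∈ integrableSubring M) :
    o ∈ integrableSubring M := by
  rw [mem_integrableSubring] at h1 h2 ⊢
  rw [map_mul, Derivation.leibniz, ← algebra_compatible_smul, ← algebra_compatible_smul] at h2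
  have h3 := M.sub_mem h2 (M.smul_mem o h1)
  rw [add_sub_cancel_left] at h3
  obtain ⟨s, rfl⟩ := hs
  have h4 := M.smul_mem (s⁻¹ : Oˣ).1 h3
  rwa [smul_smul, Units.inv_mul, one_smul] at h4

theorem inv_smul_D_mem {w : O} (hw : IsUnit w) (h : w ∈ integrableSubring M) :
    (algebraMap O K w)⁻¹ • KaehlerDifferential.D k K (algebraMap O K w) ∈ M := by
  obtain ⟨w, rfl⟩ := hw
  have e : (algebraMap O K w)⁻¹ = algebraMap O K (w⁻¹ : Oˣ).1 := by
    rw [eq_comm]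
    refine eq_inv_of_mul_eq_one_left ?_
    rw [← map_mul, Units.inv_mul, map_one]
  rw [e, ← algebra_compatible_smul]
  exact M.smul_mem _ h

/-- The logarithmic differential of a product. -/
theorem inv_smul_D_mul {s t : K} (hs : s ≠ 0) (ht : t ≠ 0) :
    (s * t)⁻¹ • KaehlerDifferential.D k K (s * t) =
      s⁻¹ • KaehlerDifferential.D k K s + t⁻¹ • KaehlerDifferential.D k K t := by
  rw [Derivation.leibniz, smul_add, smul_smul, smul_smul, add_comm]
  congr 2 <;> field_simp

/-- The logarithmic differential of `s t⁴` when `dt = 2s ds`. -/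
theorem smul_inv_smul_D_mul_pow_four {s t : K} (hs : s ≠ 0) (ht : t ≠ 0)
    (h : KaehlerDifferential.D k K t = (2 * s) • KaehlerDifferential.D k K s) :
    s • ((s * t ^ 4)⁻¹ • KaehlerDifferential.D k K (s * t ^ 4)) =
      (8 * s ^ 2 + t) • (t⁻¹ • KaehlerDifferential.D k K s) := by
  have h4 : KaehlerDifferential.D k K (t ^ 4) =
      (4 * t ^ 3 * (2 * s)) • KaehlerDifferential.D k K s := by
    rw [Derivation.leibniz_pow, h, ← Nat.cast_smul_eq_nsmul K, smul_smul, smul_smul]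
    push_cast
    rfl
  rw [inv_smul_D_mul hs (pow_ne_zero 4 ht), h4, smul_smul, ← add_smul, smul_smul, smul_smul]
  congr 1
  field_simp
  ring

end Derivation

namespace Example

open AlgebraicGeometry Polynomial

section Affine

variable {A : Type} [CommRing A] [IsDomain A] [Algebra ℚ A] [Algebra.FiniteType ℚ A]

/-- A regular function on an affine variety as a rational function. -/
def ratFun : A →+* (affineVariety A).K := germ (genericPoint (affineVariety A).X)

theorem algebraMap_germ (p : (affineVariety A).X) (c : A) :
    algebraMap ((affineVariety A).X.presheaf.stalk p) (affineVariety A).K (germ p c) = ratFun c :=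
  congrArg (fun r => r c) (specStalk_stalkSpecializes (A := A)
    ((genericPoint_spec (affineVariety A).X).specializes (Set.mem_univ p)))

theorem ratFun_ne_zero {c : A} (hc : c ≠ 0) : (ratFun c : (affineVariety A).K) ≠ 0 :=
  (map_ne_zero_iff _ (specStalk_injective (A := A) (genericPoint (affineVariety A).X))).mpr hc

theorem exists_germ_mul_eq (p : (affineVariety A).X) (o : (affineVariety A).X.presheaf.stalk p) :
    ∃ c s : A, IsUnit (germ p s) ∧ o * germ p s = germ p c :=
  exists_specStalk_mul_eq (A := A) p o

end Affine

theorem stalkMap_germ (p : curve.X) (c : ℚ[X]) :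
    (f.hom.stalkMap p).hom (germ (A := ℚ[X]) (f.hom p) c) = germ p (aeval (y * x ^ 4) c) :=
  congrArg (fun r => r c)
    (stalkMap_specStalk (aeval (y * x ^ 4) : ℚ[X] →ₐ[ℚ] R).toRingHom p)

theorem funMap_ratFun (c : ℚ[X]) :
    f.funMap (ratFun c) = ratFun (aeval (y * x ^ 4) c) := by
  have h := congrArg (fun r => r c) (specStalk_stalkSpecializes (A := ℚ[X])
    (specializes_of_eq f.apply_genericPoint))
  exact (congrArg (f.hom.stalkMap (genericPoint curve.X)).hom h).trans (stalkMap_germ _ c)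

theorem isNonsingularAt_a : IsNonsingularAt curve curveU a := by
  have h1 : IsNoetherianRing (curve.X.presheaf.stalk a) := by
    have : IsNoetherianRing R := Algebra.FiniteType.isNoetherianRing ℚ R
    exact isNoetherianRing_stalk_Spec (A := R) a
  have h2 : (IsLocalRing.maximalIdeal (curve.X.presheaf.stalk a)).IsPrincipal :=
    ⟨_, maximalIdeal_stalk_pt isMaximal_span_x⟩
  have h3 : IsPrincipalIdealRing (curve.X.presheaf.stalk a) :=
    ((tfae_of_isNoetherianRing_of_isLocalRing_of_isDomain (curve.X.presheaf.stalk a)).out 0 4).mpr h2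
  refine ⟨inferInstance, Or.inr ?_⟩
  have e : localIdeal (curveU : Set curve.X)ᶜ a =
      IsLocalRing.maximalIdeal (curve.X.presheaf.stalk a) :=
    (localIdeal_compl_nonvanishing isMaximal_span_x a).trans
      (maximalIdeal_stalk_pt isMaximal_span_x).symm
  rw [e]
  let _ := Ideal.Quotient.field (IsLocalRing.maximalIdeal (curve.X.presheaf.stalk a))
  infer_instance

/-- The form `dz/z` is logarithmic at every point of `B`. -/
theorem dlog_mem_logForms (p : line.X) :
    (ratFun (X : ℚ[X]))⁻¹ • KaehlerDifferential.D ℚ line.K (ratFun (X : ℚ[X])) ∈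
      logForms line lineU p := by
  refine ⟨⊤, trivial, fun q _ _ => Submodule.subset_span (Or.inr ⟨germ q (X : ℚ[X]), ?_, ?_⟩)⟩
  · exact (localIdeal_compl_nonvanishing isMaximal_span_X q).symm
  · rw [algebraMap_germ]

theorem y_ne_zero : y ≠ 0 := isUnit_y.ne_zero

/-- A submodule containing `dy` contains the differentials of all elements of the local ring. -/
theorem integrableSubring_eq_top (p : curve.X)
    (M : Submodule (curve.X.presheaf.stalk p) Ω[curve.K⁄ℚ])
    (hM : KaehlerDifferential.D ℚ curve.K (ratFun y) ∈ M) : integrableSubring M = ⊤ := by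
  rw [eq_top_iff]
  intro o _
  have hy : germ p y ∈ integrableSubring M := by
    rwa [mem_integrableSubring, algebraMap_germ]
  have hQ (r : ℚ) : germ p (algebraMap ℚ R r) ∈ integrableSubring M := by
    rw [mem_integrableSubring]
    have : algebraMap (curve.X.presheaf.stalk p) curve.K (germ p (algebraMap ℚ R r)) =
        algebraMap ℚ curve.K r :=
      congrArg (fun φ : ℚ →+* curve.K => φ r) (Subsingleton.elim
        (((algebraMap (curve.X.presheaf.stalk p) curve.K).comp (germ p)).comp (algebraMap ℚ R)) _)
    rw [this, Derivation.map_algebraMap]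
    exact M.zero_mem
  have hR (c : R) : germ p c ∈ integrableSubring M := by
    obtain ⟨n, P, h⟩ := exists_pow_mul c
    refine mem_integrableSubring_of_mul_mem (s := germ p (y ^ n)) ((isUnit_y.pow n).map _) ?_ ?_
    · rw [map_pow]
      exact Subring.pow_mem _ hy n
    · rw [← map_mul, mul_comm, h, aeval_eq_sum_range, map_sum]
      refine Subring.sum_mem _ fun i _ => ?_
      rw [Algebra.smul_def, map_mul, map_pow]
      exact Subring.mul_mem _ (hQ _) (Subring.pow_mem _ hy i)
  obtain ⟨c, s, hs, h⟩ := exists_germ_mul_eq p o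
  exact mem_integrableSubring_of_mul_mem hs (hR s) (h ▸ hR c)

/-- The pull-back of `dz/z` is `dy/y + 4 dx/x = (8y² + x)/y · dy/x`, which generates the
logarithmic forms at `a` since `8y² + x` is a unit there. -/
theorem logGerms_le (M : Submodule (curve.X.presheaf.stalk a) Ω[curve.K⁄ℚ])
    (hM : (ratFun (y * x ^ 4))⁻¹ • KaehlerDifferential.D ℚ curve.K (ratFun (y * x ^ 4)) ∈ M) :
    logGerms curve curveU a ≤ M := by
  have hy0 := ratFun_ne_zero y_ne_zero
  have hx0 := ratFun_ne_zero x_ne_zero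
  have hDx : KaehlerDifferential.D ℚ curve.K (ratFun x) =
      (2 * ratFun y : curve.K) • KaehlerDifferential.D ℚ curve.K (ratFun y) := by
    rw [rel, map_add, map_pow, map_one, map_add, Derivation.leibniz_pow, Derivation.map_one_eq_zero,
      add_zero, ← Nat.cast_smul_eq_nsmul curve.K, smul_smul]
    simp
  have hu : IsUnit (germ a (8 * y ^ 2 + x)) := by
    by_contra h
    have h1 := (germ_mem_maximalIdeal_iff a _).mp h
    have h2 := (Ideal.add_mem_iff_left _ (Ideal.mem_span_singleton_self x)).mp h1
    have h8 : IsUnit (8 : R) := by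
      have := (isUnit_iff_ne_zero.mpr (by norm_num : (8 : ℚ) ≠ 0)).map (algebraMap ℚ R)
      rwa [map_ofNat] at this
    exact isMaximal_span_x.ne_top (Ideal.eq_top_of_isUnit_mem _ h2 (h8.mul (isUnit_y.pow 2)))
  have hdy : (ratFun x : curve.K)⁻¹ • KaehlerDifferential.D ℚ curve.K (ratFun y) ∈ M := by
    obtain ⟨u, hu⟩ := hu
    have h1 := M.smul_mem ((u⁻¹ : (curve.X.presheaf.stalk a)ˣ) : curve.X.presheaf.stalk a)
      (M.smul_mem (germ a y) hM)
    have h3 : (ratFun (y * x ^ 4) : curve.K) = ratFun y * ratFun x ^ 4 := by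
      rw [map_mul, map_pow]
    have h4 : (ratFun (8 * y ^ 2 + x) : curve.K) = 8 * ratFun y ^ 2 + ratFun x := by
      rw [map_add, map_mul, map_pow, map_ofNat]
    have h2 : germ a y • ((ratFun (y * x ^ 4))⁻¹ •
        KaehlerDifferential.D ℚ curve.K (ratFun (y * x ^ 4))) =
        (u : curve.X.presheaf.stalk a) •
          ((ratFun x : curve.K)⁻¹ • KaehlerDifferential.D ℚ curve.K (ratFun y)) := by
      rw [hu, algebra_compatible_smul curve.K, algebraMap_germ,
        algebra_compatible_smul curve.K (germ a (8 * y ^ 2 + x)), algebraMap_germ, h3, h4]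
      exact smul_inv_smul_D_mul_pow_four hy0 hx0 hDx
    rwa [h2, smul_smul, Units.inv_mul, one_smul] at h1
  have hdy' : KaehlerDifferential.D ℚ curve.K (ratFun y) ∈ M := by
    have := M.smul_mem (germ a x) hdy
    rwa [algebra_compatible_smul curve.K, algebraMap_germ, smul_smul, mul_inv_cancel₀ hx0,
      one_smul] at this
  have htop := integrableSubring_eq_top a M hdy'
  have hall (o : curve.X.presheaf.stalk a) : o ∈ integrableSubring M := by
    rw [htop]
    trivial
  refine Submodule.span_le.mpr ?_
  rintro _ (⟨g, rfl⟩ | ⟨h, hh, rfl⟩)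
  · exact hall g
  · have hh' := hh.trans (localIdeal_compl_nonvanishing isMaximal_span_x a)
    obtain ⟨w, hw⟩ := Ideal.span_singleton_eq_span_singleton.mp hh'.symm
    have hw0 : algebraMap (curve.X.presheaf.stalk a) curve.K (w : curve.X.presheaf.stalk a) ≠ 0 :=
      (w.isUnit.map _).ne_zero
    rw [← hw, map_mul, algebraMap_germ, inv_smul_D_mul hx0 hw0]
    refine M.add_mem ?_ (inv_smul_D_mem w.isUnit (hall _))
    rw [hDx, smul_comm]
    have := M.smul_mem (germ a (2 * y)) hdy
    rwa [algebra_compatible_smul curve.K, algebraMap_germ, map_mul, map_ofNat] at this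

theorem isLogSmoothAt_a : IsLogSmoothAt curveU lineU f a := by
  refine ⟨curveU_le, isDominant_f, ?_⟩
  set N := Submodule.span (curve.X.presheaf.stalk a)
    (pullForm f.funMap '' (logForms line lineU (f.hom a) : Set Ω[line.K⁄ℚ]))
  have hN : (ratFun (y * x ^ 4))⁻¹ • KaehlerDifferential.D ℚ curve.K (ratFun (y * x ^ 4)) ∈ N := by
    refine Submodule.subset_span ⟨_, dlog_mem_logForms (f.hom a), ?_⟩
    rw [pullForm_smul_D, map_inv₀, funMap_ratFun, aeval_X]
  have hle : logForms curve curveU a ≤ N := by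
    rintro ω ⟨W, hW, h⟩
    exact logGerms_le N hN (h a hW isNonsingularAt_a)
  have htop : N.submoduleOf (logForms curve curveU a) = ⊤ := by
    rw [eq_top_iff]
    exact fun ω _ => hle ω.2
  rw [htop]
  have : Subsingleton (logForms curve curveU a ⧸
      (⊤ : Submodule (curve.X.presheaf.stalk a) (logForms curve curveU a))) :=
    Submodule.Quotient.subsingleton_iff.mpr rfl
  exact Module.Free.of_subsingleton _ _

end Example

end

/-! ### Truncations of the henselization -/

noncomputable section

namespace Henselization

open IsLocalRing

variable {A : Type u} [CommRing A] [IsLocalRing A]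

theorem hom_ext {S : Type u} [CommRing S] {φ ψ : Henselization A →+* S}
    (h : ∀ N : EtaleNbhd A, φ.comp (ι N) = ψ.comp (ι N)) : φ = ψ := by
  have e : CommRingCat.ofHom φ = CommRingCat.ofHom ψ :=
    Limits.colimit.hom_ext (F := EtaleNbhd.diagram A) fun N => congrArg CommRingCat.ofHom (h N)
  exact congrArg CommRingCat.Hom.hom e

theorem toResidue_compat {N M : EtaleNbhd A} (φ : N ⟶ M) :
    M.pt.toRingHom.comp φ.1.toRingHom = N.pt.toRingHom :=
  congrArg AlgHom.toRingHom φ.2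

variable (A) in
/-- The homomorphism from the henselization to the residue field given by the points of the étale
neighbourhoods. -/
def toResidue : Henselization A →+* ResidueField A :=
  desc (fun N => N.pt.toRingHom) toResidue_compat

theorem toResidue_ι (N : EtaleNbhd A) (c : N.coord) : toResidue A (ι N c) = N.pt c :=
  congrArg (fun r => r c) (desc_comp_ι (fun N => N.pt.toRingHom) toResidue_compat N)

variable (A) in
/-- The trivial étale neighbourhood. -/
def trivialNbhd : EtaleNbhd A := EtaleNbhd.ofEtale A (Algebra.ofId A (ResidueField A))

theorem toResidue_of (c : A) : toResidue A (of A c) = residue A c := by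
  rw [← ι_algebraMap (trivialNbhd A), toResidue_ι, AlgHom.commutes]
  rfl

theorem toResidue_map {A' : Type u} [CommRing A'] [IsLocalRing A'] (f : A →+* A') [IsLocalHom f]
    (h : Henselization A) : toResidue A' (map f h) = ResidueField.map f (toResidue A h) := by
  let _ := f.toAlgebra
  have : IsLocalHom (algebraMap A A') := ‹IsLocalHom f›
  suffices e : (toResidue A').comp (map f) = (ResidueField.map f).comp (toResidue A) from
    congrArg (fun r => r h) e
  refine hom_ext fun N => RingHom.ext fun c => ?_
  have h1 : map f (ι N c) = ι (baseChange A' N) (toBaseChange A' N c) :=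
    congrArg (fun r => r c)
      (desc_comp_ι (fun N => (ι (baseChange A' N)).comp (toBaseChange A' N)) ι_toBaseChange N)
  simp only [RingHom.comp_apply]
  rw [h1, toResidue_ι, toResidue_ι, toBaseChange_apply, pt_baseChange]
  refine (congrArg (basePt N) ((baseChangeEquiv A' N).apply_symm_apply _)).trans ?_
  rw [basePt, Algebra.TensorProduct.lift_tmul, map_one, one_mul]
  rfl

variable (A) in
/-- The reduction of the truncated ring `A / 𝔪ⁿ⁺¹` to the residue field. -/
def truncResidue (n : ℕ) : A ⧸ maximalIdeal A ^ (n + 1) →ₐ[A] ResidueField A :=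
  Ideal.Quotient.liftₐ _ (Algebra.ofId A (ResidueField A)) fun c hc =>
    (residue_eq_zero_iff c).mpr (Ideal.pow_le_self n.succ_ne_zero hc)

theorem truncResidue_mk (n : ℕ) (c : A) :
    truncResidue A n (Ideal.Quotient.mk _ c) = residue A c := rfl

theorem truncResidue_surjective (n : ℕ) : Function.Surjective (truncResidue A n) := by
  intro c
  obtain ⟨c, rfl⟩ := residue_surjective c
  exact ⟨Ideal.Quotient.mk _ c, truncResidue_mk n c⟩

theorem isNilpotent_ker_truncResidue (n : ℕ) :
    IsNilpotent (RingHom.ker (truncResidue A n : A ⧸ maximalIdeal A ^ (n + 1) →+* ResidueField A)) := by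
  refine ⟨n + 1, ?_⟩
  rw [Ideal.zero_eq_bot, eq_bot_iff]
  have h : RingHom.ker (truncResidue A n : A ⧸ maximalIdeal A ^ (n + 1) →+* ResidueField A) ≤
      (maximalIdeal A).map (Ideal.Quotient.mk (maximalIdeal A ^ (n + 1))) := by
    intro c hc
    obtain ⟨c, rfl⟩ := Ideal.Quotient.mk_surjective c
    exact Ideal.mem_map_of_mem _ ((residue_eq_zero_iff c).mp hc)
  refine (Ideal.pow_right_mono h (n + 1)).trans ?_
  rw [← Ideal.map_pow, Ideal.map_quotient_self]

/-- The lift of the point of an étale neighbourhood to `A / 𝔪ⁿ⁺¹`. -/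
def truncLift (n : ℕ) (N : EtaleNbhd A) : N.coord →ₐ[A] A ⧸ maximalIdeal A ^ (n + 1) :=
  Algebra.FormallySmooth.liftOfSurjective N.pt (truncResidue A n) (truncResidue_surjective n)
    (isNilpotent_ker_truncResidue n)

theorem truncResidue_truncLift (n : ℕ) (N : EtaleNbhd A) (c : N.coord) :
    truncResidue A n (truncLift n N c) = N.pt c :=
  Algebra.FormallySmooth.liftOfSurjective_apply _ _ _ (isNilpotent_ker_truncResidue n) _

theorem truncLift_compat (n : ℕ) {N M : EtaleNbhd A} (φ : N ⟶ M) :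
    (truncLift n M).toRingHom.comp φ.1.toRingHom = (truncLift n N).toRingHom := by
  have e : (truncLift n M).comp φ.1 = truncLift n N := by
    refine Algebra.FormallyUnramified.lift_unique' (truncResidue A n)
      (isNilpotent_ker_truncResidue n) _ _ (AlgHom.ext fun c => ?_)
    simp only [AlgHom.comp_apply, truncResidue_truncLift]
    exact congrArg (fun r => r c) φ.2
  exact congrArg AlgHom.toRingHom e

/-- The homomorphism from the henselization to `A / 𝔪ⁿ⁺¹`: points of étale algebras lift uniquely
along nilpotent thickenings. -/
def trunc (n : ℕ) : Henselization A →+* A ⧸ maximalIdeal A ^ (n + 1) :=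
  desc (fun N => (truncLift n N).toRingHom) (truncLift_compat n)

theorem trunc_ι (n : ℕ) (N : EtaleNbhd A) (c : N.coord) : trunc n (ι N c) = truncLift n N c :=
  congrArg (fun r => r c) (desc_comp_ι (fun N => (truncLift n N).toRingHom) (truncLift_compat n) N)

theorem trunc_of (n : ℕ) (c : A) : trunc n (of A c) = Ideal.Quotient.mk _ c := by
  rw [← ι_algebraMap (trivialNbhd A), trunc_ι, AlgHom.commutes]
  rfl

theorem truncResidue_trunc (n : ℕ) (h : Henselization A) :
    truncResidue A n (trunc n h) = toResidue A h := by
  suffices e : (truncResidue A n : A ⧸ maximalIdeal A ^ (n + 1) →+* ResidueField A).comp (trunc n) =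
      toResidue A from congrArg (fun r => r h) e
  refine hom_ext fun N => RingHom.ext fun c => ?_
  simp only [RingHom.comp_apply]
  rw [trunc_ι, toResidue_ι]
  exact truncResidue_truncLift n N c

/-- A power of a generator of the maximal ideal may be cancelled in the henselization, as far as
residues are concerned. -/
theorem toResidue_eq_of_pow_mul_eq [IsDomain A] {ϖ : A} (hϖ : maximalIdeal A = Ideal.span {ϖ})
    (hϖ0 : ϖ ≠ 0) (n : ℕ) {g h : Henselization A}
    (e : of A ϖ ^ n * g = of A ϖ ^ n * h) : toResidue A g = toResidue A h := by
  obtain ⟨w, hw⟩ := Ideal.Quotient.mk_surjective (trunc n (g - h))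
  have h1 : of A ϖ ^ n * (g - h) = 0 := by rw [mul_sub, e, sub_self]
  have h2 := congrArg (trunc n) h1
  rw [map_mul, map_pow, trunc_of, ← hw, map_zero, ← map_pow, ← map_mul,
    Ideal.Quotient.eq_zero_iff_mem, hϖ, Ideal.span_singleton_pow, Ideal.mem_span_singleton,
    pow_succ, mul_dvd_mul_iff_left (pow_ne_zero n hϖ0)] at h2
  have h3 : residue A w = 0 := by
    rw [residue_eq_zero_iff, hϖ, Ideal.mem_span_singleton]
    exact h2
  rw [← sub_eq_zero, ← map_sub, ← truncResidue_trunc n, ← hw, truncResidue_mk, h3]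

end Henselization

/-! ### The residue fields of `a` and `b`, and units of the henselizations -/

namespace Example

open AlgebraicGeometry Polynomial IsLocalRing

theorem maximalIdeal_stalk_a :
    maximalIdeal (curve.X.presheaf.stalk a) = Ideal.span {germ a x} :=
  maximalIdeal_stalk_pt isMaximal_span_x

theorem residue_germ_x : residue (curve.X.presheaf.stalk a) (germ a x) = 0 := by
  rw [residue_eq_zero_iff, germ_mem_maximalIdeal_iff]
  exact Ideal.mem_span_singleton_self x

/-- Every element of the residue field of a point of an affine variety is a quotient of residues of
regular functions. -/
theorem exists_eq_residue_div {A : Type} [CommRing A] [IsDomain A] [Algebra ℚ A]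
    [Algebra.FiniteType ℚ A] (p : (affineVariety A).X)
    (o : ResidueField ((affineVariety A).X.presheaf.stalk p)) :
    ∃ c s : A, o = residue _ (germ p c) * (residue _ (germ p s))⁻¹ := by
  obtain ⟨o, rfl⟩ := residue_surjective o
  obtain ⟨c, s, hs, h⟩ := exists_germ_mul_eq p o
  refine ⟨c, s, ?_⟩
  rw [← h, map_mul, mul_inv_cancel_right₀ (hs.map (residue _)).ne_zero]

instance charZero_residueField {A : Type} [CommRing A] [IsDomain A] [Algebra ℚ A]
    [Algebra.FiniteType ℚ A] (p : (affineVariety A).X) :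
    CharZero (ResidueField ((affineVariety A).X.presheaf.stalk p)) := by
  let φ := ((residue _).comp (germ p)).comp (algebraMap ℚ A)
  exact charZero_of_injective_ringHom φ.injective

/-- The residue field of `a` is `ℚ(√-1)`. -/
theorem residueField_a (o : ResidueField (curve.X.presheaf.stalk a)) :
    ∃ p q : ℚ, o = (p : ResidueField (curve.X.presheaf.stalk a)) + q * residue _ (germ a y) := by
  let φ : R →+* ResidueField (curve.X.presheaf.stalk a) := (residue _).comp (germ a)
  have hi : φ y ^ 2 = -1 := apply_y_sq φ residue_germ_x
  obtain ⟨c, s, rfl⟩ := exists_eq_residue_div a o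
  obtain ⟨p, q, h⟩ := exists_apply_eq_add_mul φ residue_germ_x c
  obtain ⟨p', q', h'⟩ := exists_apply_eq_add_mul φ residue_germ_x s
  obtain ⟨p'', q'', h''⟩ := exists_inv_eq_add_mul_sqrt_neg_one hi p' q'
  refine ⟨p * p'' - q * q'', p * q'' + q * p'', ?_⟩
  change φ c * (φ s)⁻¹ = _ + _ * φ y
  rw [h, h', h'']
  push_cast
  linear_combination (q * q'' : ResidueField (curve.X.presheaf.stalk a)) * hi

/-- The residue field of `b` is `ℚ`. -/
theorem residueField_b (p : line.X) (hp : p = b) (o : ResidueField (line.X.presheaf.stalk p)) :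
    ∃ r : ℚ, o = r := by
  let φ : ℚ[X] →+* ResidueField (line.X.presheaf.stalk p) := (residue _).comp (germ p)
  have hφ (c : ℚ[X]) : φ c = (c.coeff 0 : ℚ) := by
    have h1 : φ X = 0 := by
      refine (residue_eq_zero_iff _).mpr ((germ_mem_maximalIdeal_iff p _).mpr ?_)
      rw [hp]
      exact Ideal.mem_span_singleton_self X
    have h2 : φ (C (c.coeff 0)) = (c.coeff 0 : ℚ) := eq_ratCast (φ.comp C) _
    have h3 := congrArg φ (divX_mul_X_add c)
    rw [map_add, map_mul, h1, mul_zero, zero_add, h2] at h3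
    exact h3.symm
  obtain ⟨c, s, rfl⟩ := exists_eq_residue_div p o
  refine ⟨c.coeff 0 * (s.coeff 0)⁻¹, ?_⟩
  change φ c * (φ s)⁻¹ = _
  rw [hφ, hφ]
  push_cast
  rfl

/-- In `z u = (x v)⁴` one may cancel `x⁴` up to residues; then `√-1 r = β⁴` for the residues `r` of
`u` and `β` of `v`, where `r` is rational as the residue field of `b` is `ℚ`. -/
theorem not_exists_units_henselization :
    ¬ ∃ (u : (Henselization (line.X.presheaf.stalk (f.hom a)))ˣ)
          (v : (Henselization (curve.X.presheaf.stalk a))ˣ),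
        Henselization.map (f.hom.stalkMap a).hom
            (Henselization.of _ (germ (A := ℚ[X]) (f.hom a) X) *
              (u : Henselization (line.X.presheaf.stalk (f.hom a)))) =
          (Henselization.of _ (germ (A := R) a x) *
            (v : Henselization (curve.X.presheaf.stalk a))) ^ 4 := by
  rintro ⟨u, v, h⟩
  have h1 : Henselization.of _ (germ (A := R) a x) ^ 4 *
      (Henselization.of _ (germ (A := R) a y) *
        Henselization.map (f.hom.stalkMap a).hom u.1) =
      Henselization.of _ (germ (A := R) a x) ^ 4 * v.1 ^ 4 := by
    rw [map_mul, Henselization.map_of] at h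
    have h2 := stalkMap_germ a X
    rw [aeval_X] at h2
    have h3 := (congrArg (fun c => Henselization.of (curve.X.presheaf.stalk a) c *
      Henselization.map (f.hom.stalkMap a).hom u.1) h2).symm.trans h
    rw [map_mul, map_pow, map_mul, map_pow, mul_pow] at h3
    rw [← h3]
    ring
  have hx0 : germ (A := R) a x ≠ 0 :=
    (map_ne_zero_iff _ (specStalk_injective (A := R) a)).mpr x_ne_zero
  have h2 := Henselization.toResidue_eq_of_pow_mul_eq
    maximalIdeal_stalk_a hx0 4 h1
  rw [map_mul, Henselization.toResidue_of, Henselization.toResidue_map, map_pow] at h2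
  obtain ⟨r, hr⟩ := residueField_b _ ((f_eq_b_iff a).mpr rfl) (Henselization.toResidue _ u.1)
  obtain ⟨p, q, hpq⟩ := residueField_a (Henselization.toResidue _ v.1)
  have hr0 : (r : ResidueField (curve.X.presheaf.stalk a)) ≠ 0 := by
    intro h0
    have h3 : (r : ResidueField (line.X.presheaf.stalk (f.hom a))) = 0 := by
      rw [Rat.cast_eq_zero.mp h0, Rat.cast_zero]
    exact ((u.isUnit.map (Henselization.toResidue _)).ne_zero) (hr.trans h3)
  rw [hr, hpq, map_ratCast] at h2
  refine sqrt_neg_one_ne_mul_pow_four (apply_y_sq ((residue _).comp (germ a)) residue_germ_x)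
    r⁻¹ p q ?_
  rw [RingHom.comp_apply]
  rw [Rat.cast_inv, ← div_eq_inv_mul, eq_div_iff hr0]
  exact h2

end Example

end

/-! ### Monomial forms at `a` -/

noncomputable section

open AlgebraicGeometry IsLocalRing

/-- Two generators of the maximal ideal have the same order, so a monomial relation between them
leaves a relation between units. -/
theorem exists_pow_eq_of_pow_eq_pow_mul {S : Type*} [CommRing S] [IsDomain S] [IsLocalRing S]
    {s ξ w : S} {d n : ℕ} (hs : Ideal.span {s} = maximalIdeal S)
    (hξ : Ideal.span {ξ} = maximalIdeal S) (hξ0 : ξ ≠ 0) (hw : IsUnit w)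
    (h : s ^ d = ξ ^ n * w) : ∃ v : S, v ^ n = w := by
  obtain ⟨v, rfl⟩ := Ideal.span_singleton_eq_span_singleton.mp (hξ.trans hs.symm)
  have hnu : ¬ IsUnit ξ := fun hu => (maximalIdeal.isMaximal S).ne_top
    (hξ.symm.trans (Ideal.span_singleton_eq_top.mpr hu))
  rw [mul_pow] at h
  have hpow {i j : ℕ} {α β : S} (hα : IsUnit α) (e : ξ ^ i * α = ξ ^ j * β) : j ≤ i := by
    by_contra! hij
    obtain ⟨l, rfl⟩ := Nat.exists_eq_add_of_lt hij
    rw [add_assoc, pow_add, mul_assoc] at e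
    rw [mul_left_cancel₀ (pow_ne_zero i hξ0) e, pow_succ', mul_assoc] at hα
    exact hnu (isUnit_of_mul_isUnit_left hα)
  obtain rfl : d = n := le_antisymm (hpow hw h.symm) (hpow (v.isUnit.pow d) h)
  exact ⟨v, mul_left_cancel₀ (pow_ne_zero d hξ0) h⟩

namespace AlgebraicGeometry

theorem span_pointHom_eq_maximalIdeal {Y : Scheme.{0}} {A : Type} [CommRing A]
    (h : Y ⟶ Spec (CommRingCat.of A)) [Etale h] (y : Y) {c : A}
    (hc : pointIdeal (h y) = Ideal.span {c}) :
    Ideal.span {pointHom h y c} = maximalIdeal (Y.presheaf.stalk y) := by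
  have := (Etale.iff_flat_and_formallyUnramified.mp ‹Etale h›).2.1
  rw [← map_pointIdeal h y, hc, Ideal.map_span, Set.image_singleton]

end AlgebraicGeometry

/-- In dimension at most one, the point of a chart under a point of the boundary is the origin of
the toric variety, cut out by the character generating the monoid. -/
theorem EtaleChart.exists_generator {V : Variety ℚ} {U : V.X.Opens} {x : V.X}
    (c : EtaleChart V U x) (hx : x ∉ U) (hn : c.T.n ≤ 1) :
    ∃ e : c.T.S, (∀ m, ∃ d : ℕ, m = d • e) ∧
      pointIdeal (A := AddMonoidAlgebra ℚ c.T.S) (c.φ ⟨x, c.mem⟩) =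
        Ideal.span {c.T.character ℚ e} := by
  obtain ⟨W', hW', h⟩ := c.preimage_torus
  exact AffineToric.exists_generator hn _ (mt (h ⟨x, c.mem⟩ hW').mpr hx)

namespace AffineToric

variable {T T' : AffineToric} {Y : Scheme.{0}}

theorem pointHom_toricMap (φ : Y ⟶ T'.scheme ℚ) (g : T.S →+ T'.S) (y : Y) (m : T.S) :
    pointHom (A := AddMonoidAlgebra ℚ T.S) (φ ≫ toricMap ℚ g) y (T.character ℚ m) =
      pointHom (A := AddMonoidAlgebra ℚ T'.S) φ y (T'.character ℚ (g m)) := by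
  refine (congrArg (fun r => r (T.character ℚ m)) (pointHom_SpecMap
    (B := AddMonoidAlgebra ℚ T'.S) φ (AddMonoidAlgebra.mapDomainAlgHom ℚ ℚ g).toRingHom y)).trans ?_
  refine congrArg (pointHom (A := AddMonoidAlgebra ℚ T'.S) φ y) ?_
  exact AddMonoidAlgebra.mapDomain_single

theorem pointHom_translation (φ : Y ⟶ T.scheme ℚ) (t : Multiplicative (Fin T.n → ℤ) →* ℚˣ) (y : Y)
    (m : T.S) : ∃ r : ℚˣ,
    pointHom (A := AddMonoidAlgebra ℚ T.S) (φ ≫ translation t) y (T.character ℚ m) =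
      pointHom (A := AddMonoidAlgebra ℚ T.S) φ y (algebraMap ℚ _ (r : ℚ)) *
        pointHom (A := AddMonoidAlgebra ℚ T.S) φ y (T.character ℚ m) := by
  refine ⟨t (Multiplicative.ofAdd (m : Fin T.n → ℤ)), ?_⟩
  refine (congrArg (fun r => r (T.character ℚ m)) (pointHom_SpecMap
    (B := AddMonoidAlgebra ℚ T.S) φ _ y)).trans ?_
  rw [← map_mul]
  refine congrArg (pointHom (A := AddMonoidAlgebra ℚ T.S) φ y) ?_
  refine (AddMonoidAlgebra.lift_single _ _ _).trans ?_
  simp [character, AddMonoidAlgebra.single_mul_single]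

end AffineToric

namespace AlgebraicGeometry

theorem Etale.ι {Y : Scheme.{u}} (W : Y.Opens) : Etale W.ι := inferInstance

theorem Etale.comp {X Y Z : Scheme.{u}} {g : X ⟶ Y} {h : Y ⟶ Z} (hg : Etale g) (hh : Etale h) :
    Etale (g ≫ h) := inferInstance

end AlgebraicGeometry

namespace Example

open Polynomial

theorem a_notMem_curveU : a ∉ curveU := fun h => h (Ideal.mem_span_singleton_self x)

theorem f_notMem_lineU {p : curve.X} (hp : p = a) : f.hom p ∉ lineU := by
  rw [(f_eq_b_iff p).mpr hp]
  exact fun h => h (Ideal.mem_span_singleton_self X)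

theorem chart_line_n_le_one {p : line.X} (c : EtaleChart line lineU p) : c.T.n ≤ 1 := by
  have := c.etale
  have : Nonempty c.W := ⟨⟨p, c.mem⟩⟩
  let h : c.W.toScheme ⟶ Spec (CommRingCat.of ℚ[X]) := c.W.ι
  have hh : Etale h := Etale.ι _
  exact toric_n_le_one_of_etale h c.φ

theorem chart_n_le_one {X' : Variety ℚ} (π : X'.Hom curve) [Etale π.hom] {U : X'.X.Opens}
    {x' : X'.X} (c : EtaleChart X' U x') : c.T.n ≤ 1 := by
  have := c.etale
  have : Nonempty c.W := ⟨⟨x', c.mem⟩⟩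
  have hx : Etale (Spec.map (CommRingCat.ofHom (aeval x : ℚ[X] →ₐ[ℚ] R).toRingHom)) :=
    (HasRingHomProperty.Spec_iff (P := @Etale)).mpr etale_aeval_x
  have hι : Etale (c.W.ι ≫ π.hom) := (Etale.ι _).comp ‹_›
  let h : c.W.toScheme ⟶ Spec (CommRingCat.of ℚ[X]) := (c.W.ι ≫ π.hom) ≫
    Spec.map (CommRingCat.ofHom (aeval x : ℚ[X] →ₐ[ℚ] R).toRingHom)
  have hh : Etale h := hι.comp hx
  exact toric_n_le_one_of_etale h c.φ

theorem residueField_of_eq_b {p : line.X} (hp : p = b)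
    (o : ResidueField (line.X.presheaf.stalk p)) : ∃ r : ℚ, o = residue _ (germ p (C r)) := by
  obtain ⟨r, rfl⟩ := residueField_b p hp o
  exact ⟨r, (eq_ratCast (((residue _).comp (germ p)).comp C) r).symm⟩

/-- A local equation of `b` in a chart is `z` times a unit with rational residue. -/
theorem exists_eq_pointHom_mul (W : (Spec (CommRingCat.of ℚ[X])).Opens) (q : W.toScheme)
    (hq : W.ι q = b) {w : W.toScheme.presheaf.stalk q}
    (hw : Ideal.span {w} = maximalIdeal (W.toScheme.presheaf.stalk q)) :
    ∃ (u : W.toScheme.presheaf.stalk q) (r : ℚ), IsUnit u ∧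
      w = pointHom W.ι q X * u ∧
      residue (W.toScheme.presheaf.stalk q) u = residue _ (pointHom W.ι q (C r)) := by
  have hne : Nonempty W := ⟨q⟩
  have hz := span_pointHom_eq_maximalIdeal W.ι q (c := X) (by rw [hq]; rfl)
  obtain ⟨u, rfl⟩ := Ideal.span_singleton_eq_span_singleton.mp (hz.trans hw.symm)
  obtain ⟨u₀, hu₀⟩ : ∃ u₀, (W.ι.stalkMap q).hom u₀ = u :=
    (ConcreteCategory.bijective_of_isIso (W.ι.stalkMap q)).2 u
  obtain ⟨r, hr⟩ := residueField_of_eq_b hq (residue ((Spec (.of ℚ[X])).presheaf.stalk (W.ι q)) u₀)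
  refine ⟨u, r, u.isUnit, rfl, ?_⟩
  rw [← hu₀, pointHom_eq]
  exact congrArg (ResidueField.map (W.ι.stalkMap q).hom) hr

theorem residueField_of_eq_a {p : curve.X} (hp : p = a)
    (o : ResidueField (curve.X.presheaf.stalk p)) :
    ∃ α β : ℚ, o = residue _ (germ p (algebraMap ℚ R α + algebraMap ℚ R β * y)) := by
  subst hp
  obtain ⟨α, β, rfl⟩ := residueField_a o
  refine ⟨α, β, ?_⟩
  let φ : ℚ →+* ResidueField (curve.X.presheaf.stalk a) :=
    ((residue _).comp (germ a)).comp (algebraMap ℚ R)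
  simp only [map_add, map_mul]
  exact congrArg₂ (· + ·) (eq_ratCast φ α).symm (congrArg (· * _) (eq_ratCast φ β).symm)

/-- The residues at a point over `a` with the same residue field are those of the functions `α + β y`
with rational `α` and `β`. -/
theorem exists_residue_eq {Y : Scheme.{0}} (h : Y ⟶ Spec (CommRingCat.of R)) (o : Y) (ho : h o = a)
    (hs : Function.Surjective (h.residueFieldMap o)) (v : Y.presheaf.stalk o) :
    ∃ α β : ℚ, residue _ v = residue _ (pointHom h o (algebraMap ℚ R α + algebraMap ℚ R β * y)) := by
  obtain ⟨v₀, hv₀⟩ := hs (residue _ v)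
  obtain ⟨α, β, rfl⟩ := residueField_of_eq_a ho v₀
  refine ⟨α, β, hv₀.symm.trans ?_⟩
  rw [pointHom_eq]
  rfl

/-- At a point étale over `a` with the same residue field, no power of a uniformizer is `y x⁴` times a
unit with rational residue. -/
theorem pow_ne_pointHom_mul {Y : Scheme.{0}} [IsIntegral Y] (h : Y ⟶ Spec (CommRingCat.of R))
    [Etale h] (o : Y) (ho : h o = a) (hs : Function.Surjective (h.residueFieldMap o))
    {s u : Y.presheaf.stalk o}
    (hgen : Ideal.span {s} = maximalIdeal (Y.presheaf.stalk o)) (hu : IsUnit u) {r : ℚ}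
    (hr : residue _ u = residue _ (pointHom h o (algebraMap ℚ R r))) {d : ℕ} :
    s ^ d ≠ pointHom h o (y * x ^ 4) * u := by
  intro e
  have hxs := span_pointHom_eq_maximalIdeal h o (c := x) (by rw [ho]; rfl)
  have := (Etale.iff_flat_and_formallyUnramified.mp ‹Etale h›).1
  have hx0 : pointHom h o x ≠ 0 := (map_ne_zero_iff _ (pointHom_injective h o)).mpr x_ne_zero
  obtain ⟨v, hv⟩ := exists_pow_eq_of_pow_eq_pow_mul (n := 4) hgen hxs hx0
    ((isUnit_y.map (pointHom h o)).mul hu) (by rw [e, map_mul, map_pow]; ring)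
  obtain ⟨α, β, hαβ⟩ := exists_residue_eq h o ho hs v
  let φ : R →+* ResidueField (Y.presheaf.stalk o) := (residue _).comp (pointHom h o)
  have hφ (c : ℚ) : φ (algebraMap ℚ R c) = c := eq_ratCast (φ.comp (algebraMap ℚ R)) c
  have hφx : φ x = 0 := by
    refine (residue_eq_zero_iff _).mpr ?_
    rw [← hxs]
    exact Ideal.mem_span_singleton_self _
  have : CharZero (ResidueField (Y.presheaf.stalk o)) :=
    charZero_of_injective_ringHom (φ.comp (algebraMap ℚ R)).injective
  have h1 := congrArg (residue (Y.presheaf.stalk o)) hv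
  have hr0 : (r : ResidueField (Y.presheaf.stalk o)) ≠ 0 := by
    rw [← hφ r]
    exact hr.symm.trans_ne (hu.map (residue _)).ne_zero
  rw [map_pow, map_mul, hαβ, hr] at h1
  change φ (_ + _ * y) ^ 4 = φ y * φ _ at h1
  rw [map_add, map_mul, hφ, hφ, hφ] at h1
  refine sqrt_neg_one_ne_mul_pow_four (apply_y_sq φ hφx) r⁻¹ α β ?_
  rw [h1, Rat.cast_inv, mul_comm, mul_inv_cancel_right₀ hr0]

/-- On the character generating the chart of `B`, the two sides of a monomial form are a power of a
uniformizer at `x'`, and `z = y x⁴` times a unit with rational residue. -/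
theorem not_hasMonomialForm (c : EtaleChart line lineU (f.hom a)) :
    ¬ HasMonomialForm curveU lineU f a c := by
  rintro ⟨X', π, x', c', g, t, hπ, -, hx', hκ, heq⟩
  have hce := c.etale
  have hce' := c'.etale
  let O := c'.W ⊓ (π.hom ≫ f.hom) ⁻¹ᵁ c.W
  have hxO : x' ∈ O := ⟨c'.mem, by
    change f.hom (π.hom x') ∈ c.W
    rw [hx']
    exact c.mem⟩
  have hne : Nonempty O := ⟨⟨x', hxO⟩⟩
  let o : O.toScheme := ⟨x', hxO⟩
  have hoa : π.hom (O.ι o) = a := hx'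
  -- on `O` both sides of the monomial form are defined: `ψ` and `φ` are the charts, `ρ` is `f ∘ π`
  let h : O.toScheme ⟶ Spec (CommRingCat.of R) := O.ι ≫ π.hom
  have hh : Etale h := (Etale.ι _).comp ‹_›
  let i : O.toScheme ⟶ c'.W.toScheme := X'.X.homOfLE inf_le_left
  let ρ : O.toScheme ⟶ c.W.toScheme := (π.hom ≫ f.hom).resLE c.W O inf_le_right
  have hi : Etale i := inferInstance
  let ψ : O.toScheme ⟶ Spec (CommRingCat.of (AddMonoidAlgebra ℚ c'.T.S)) := i ≫ c'.φ
  have hψ : Etale ψ := hi.comp hce'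
  let φ : c.W.toScheme ⟶ Spec (CommRingCat.of (AddMonoidAlgebra ℚ c.T.S)) := c.φ
  have hφ : Etale φ := hce
  obtain ⟨e, -, hpe⟩ := c.exists_generator (f_notMem_lineU rfl) (chart_line_n_le_one c)
  obtain ⟨e', he', hpe'⟩ := c'.exists_generator
    (fun hU => a_notMem_curveU (hx' ▸ hU)) (chart_n_le_one π c')
  have hio : i o = ⟨x', c'.mem⟩ := X'.X.homOfLE_apply' _ _ _
  have hρι : ρ ≫ c.W.ι = O.ι ≫ π.hom ≫ f.hom := Scheme.Hom.resLE_comp_ι _ _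
  have hρb : c.W.ι (ρ o) = f.hom (π.hom x') := by
    rw [← Scheme.Hom.comp_apply, hρι]
    rfl
  have hρo : ρ o = ⟨f.hom a, c.mem⟩ := by
    apply c.W.ι.injective
    rw [hρb, hx']
    rfl
  have hgen : Ideal.span {pointHom ψ o (c'.T.character ℚ e')} = maximalIdeal _ :=
    span_pointHom_eq_maximalIdeal ψ o ((congrArg (fun q => pointIdeal
      (A := AddMonoidAlgebra ℚ c'.T.S) (c'.φ q)) hio).trans hpe')
  have hw : Ideal.span {pointHom φ (ρ o) (c.T.character ℚ e)} = maximalIdeal _ :=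
    span_pointHom_eq_maximalIdeal φ (ρ o) ((congrArg (fun q => pointIdeal
      (A := AddMonoidAlgebra ℚ c.T.S) (c.φ q)) hρo).trans hpe)
  obtain ⟨u, r, hu, hwu, hr⟩ := exists_eq_pointHom_mul c.W (ρ o)
    (hρb.trans ((f_eq_b_iff _).mpr hx')) hw
  -- compare the values of the two sides of the monomial form on the generating character
  have hcomp : ψ ≫ AffineToric.toricMap ℚ g = (ρ ≫ c.φ) ≫ AffineToric.translation t :=
    (Category.assoc _ _ _).trans (heq.trans (Category.assoc _ _ _).symm)
  obtain ⟨r', hR⟩ := AffineToric.pointHom_translation (ρ ≫ c.φ) t o e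
  have hL := (AffineToric.pointHom_toricMap ψ g o e).symm.trans ((congrArg (fun m => pointHom
    (A := AddMonoidAlgebra ℚ c.T.S) m o (c.T.character ℚ e)) hcomp).trans hR)
  obtain ⟨d, hd⟩ := he' (g e)
  rw [hd, AffineToric.character_nsmul, map_pow] at hL
  have hpull (p : ℚ[X]) : (ρ.stalkMap o).hom (pointHom (A := ℚ[X]) c.W.ι (ρ o) p) =
      pointHom h o (aeval (y * x ^ 4) p) := by
    have h1 := pointHom_comp (A := ℚ[X]) ρ c.W.ι o
    have h2 : pointHom (A := ℚ[X]) (ρ ≫ c.W.ι) o = _ :=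
      congrArg (fun m => pointHom (A := ℚ[X]) m o) (hρι.trans (Category.assoc _ _ _).symm)
    have h3 := pointHom_SpecMap h (aeval (y * x ^ 4) : ℚ[X] →ₐ[ℚ] R).toRingHom o
    exact congrArg (fun m => m p) (h1.symm.trans (h2.trans h3))
  have hφw : pointHom (A := AddMonoidAlgebra ℚ c.T.S) (ρ ≫ c.φ) o (c.T.character ℚ e) =
      pointHom h o (y * x ^ 4) * (ρ.stalkMap o).hom u := by
    have h1 := congrArg (fun m => m (c.T.character ℚ e))
      (pointHom_comp (A := AddMonoidAlgebra ℚ c.T.S) ρ c.φ o)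
    refine h1.trans ((congrArg (ρ.stalkMap o).hom hwu).trans ?_)
    refine (map_mul (ρ.stalkMap o).hom _ u).trans (congrArg (· * _) ?_)
    exact (hpull X).trans (congrArg (pointHom h o) (aeval_X _))
  have hrat (m : ℚ →+* O.toScheme.presheaf.stalk o) (q : ℚ) :
      m q = pointHom h o (algebraMap ℚ R q) :=
    congrArg (fun m => m q)
      (Subsingleton.elim m ((pointHom h o).comp (algebraMap ℚ R)))
  have hr' : pointHom (A := AddMonoidAlgebra ℚ c.T.S) (ρ ≫ c.φ) o (algebraMap ℚ _ (r' : ℚ)) =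
      pointHom h o (algebraMap ℚ R r') :=
    hrat ((pointHom (A := AddMonoidAlgebra ℚ c.T.S) (ρ ≫ c.φ) o).comp (algebraMap ℚ _)) r'
  have hu' : residue _ ((ρ.stalkMap o).hom u) = residue _ (pointHom h o (algebraMap ℚ R r)) := by
    refine (congrArg (ResidueField.map (ρ.stalkMap o).hom) hr).trans ?_
    refine (ResidueField.map_residue _ _).trans ?_
    exact congrArg (residue _) ((hpull (C r)).trans (congrArg (pointHom h o) (aeval_C _ r)))
  refine pow_ne_pointHom_mul h o hoa ?_ hgen (u := pointHom h o (algebraMap ℚ R r') *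
    (ρ.stalkMap o).hom u) (r := r' * r) ?_ ?_ (hL.trans ?_)
  · have hs : h.residueFieldMap o = π.hom.residueFieldMap x' ≫ O.ι.residueFieldMap o :=
      Scheme.residueFieldMap_comp O.ι π.hom o
    rw [hs]
    exact (ConcreteCategory.bijective_of_isIso (O.ι.residueFieldMap o)).2.comp hκ.2
  · exact ((r'.isUnit.map (algebraMap ℚ R)).map _).mul (hu.map (ρ.stalkMap o).hom)
  · rw [map_mul, hu', ← map_mul, ← map_mul, ← map_mul]
  · exact (congrArg₂ (· * ·) hr' hφw).trans (mul_left_comm _ _ _)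

end Example

end

theorem mainTheorem4 :
    (∃! a : Example.curve.X, Example.f.hom a = Example.b) ∧
    IsStrictToroidal Example.curve Example.curveU ∧
    IsStrictToroidal Example.line Example.lineU ∧
    (∀ a : Example.curve.X, Example.f.hom a = Example.b →
      IsClosed {a} ∧
      IsLogSmoothAt Example.curveU Example.lineU Example.f a ∧
      -- no units `u`, `v` of the henselizations with `z u = (x v)⁴`
      (¬ ∃ (u : (Henselization (Example.line.X.presheaf.stalk (Example.f.hom a)))ˣ)
          (v : (Henselization (Example.curve.X.presheaf.stalk a))ˣ),
        Henselization.map (Example.f.hom.stalkMap a).hom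
            (Henselization.of _ (Example.germ (A := Polynomial ℚ) (Example.f.hom a) Polynomial.X) *
              (u : Henselization (Example.line.X.presheaf.stalk (Example.f.hom a)))) =
          (Henselization.of _ (Example.germ (A := Example.R) a Example.x) *
            (v : Henselization (Example.curve.X.presheaf.stalk a))) ^ 4) ∧
      -- no étale chart of `B` at `f a` extends to a monomial form of `f` at `a`
      (∀ c : EtaleChart Example.line Example.lineU (Example.f.hom a),
        ¬ HasMonomialForm Example.curveU Example.lineU Example.f a c)) ∧
    -- `√-1` is not of the form `α β⁴` with `α` in `ℚ` and `β` in `ℚ(√-1)`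
    (¬ ∃ (α : ℚ) (β : ℂ), β ∈ IntermediateField.adjoin ℚ {Complex.I} ∧
      Complex.I = (α : ℂ) * β ^ 4) ∧
    -- monomial forms need not exist without an assumption on the residue field
    (¬ ∀ (k : Type) [Field k] [CharZero k] (X B : Variety k) (UX : X.X.Opens) (UB : B.X.Opens)
        (f : X.Hom B) (x : X.X) (c : EtaleChart B UB (f.hom x)),
        IsStrictToroidal X UX → IsStrictToroidal B UB → IsClosed {x} →
        IsLogSmoothAt UX UB f x → HasMonomialForm UX UB f x c) := by
  refine ⟨⟨Example.a, (Example.f_eq_b_iff _).mpr rfl, fun p hp => (Example.f_eq_b_iff p).mp hp⟩,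
    Example.isStrictToroidal_curve, Example.isStrictToroidal_line, fun p hp => ?_,
    not_exists_I_eq_mul_pow_four, fun h => ?_⟩
  · obtain rfl := (Example.f_eq_b_iff p).mp hp
    exact ⟨Example.isClosed_a, Example.isLogSmoothAt_a, Example.not_exists_units_henselization,
      Example.not_hasMonomialForm⟩
  · have hb : IsClosed {Example.f.hom Example.a} := by
      rw [(Example.f_eq_b_iff Example.a).mpr rfl]
      exact Example.isClosed_pt Example.isMaximal_span_X
    obtain ⟨c⟩ := Example.isStrictToroidal_line.1 _ hb
    exact Example.not_hasMonomialForm c (h ℚ Example.curve Example.line Example.curveU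
      Example.lineU Example.f Example.a c Example.isStrictToroidal_curve
      Example.isStrictToroidal_line Example.isClosed_a Example.isLogSmoothAt_a)
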